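/- A looped simple graph is a finite graph in which loops are allowed but no two edges have the same set of end-vertices; a simple graph is a looped simple graph without loops. For a looped simple graph $G$ let $A(G)$ be its adjacency matrix over $GF(2)$, with diagonal entry $1$ exactly at looped vertices, and let $M(IAS(G))$ be the binary matroid represented by the matrix $(I\mid A(G)\mid I+A(G))$. For $v\in V(G)$ let $v_\phi,v_\chi,v_\psi$ denote the columns of $I$, $A(G)$, $I+A(G)$ corresponding to $v$. An isomorphism $M(IAS(G_1))\to M(IAS(G_2))$ is compatible if it maps each triple $\{v_\phi,v_\chi,v_\psi\}$, $v\in V(G_1)$, onto a triple $\{w_\phi,w_\chi,w_\psi\}$, $w\in V(G_2)$. Let $N(v)$ be the set of vertices $w\neq v$ adjacent to $v$. The simple local complement of $G$ at $v$ is obtained by complementing all adjacencies between distinct elements of $N(v)$; the non-simple local complement at $v$ is obtained from it by also complementing the loop status of each element of $N(v)$. Loop complementation at $v$ reverses the loop status of $v$. Theorem. Let $G_1$ and $G_2$ be looped simple graphs. 1. If there is an isomorphism between the matroids $M(IAS(G_1))$ and $M(IAS(G_2))$, then there is a compatible isomorphism between them. 2. $M(IAS(G_1))\cong M(IAS(G_2))$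 if and only if, up to isomorphism, $G_2$ can be obtained from $G_1$ by a finite sequence of local complementations (simple or non-simple) and loop complementations. 3. If $G_1$ and $G_2$ are simple, then $M(IAS(G_1))\cong M(IAS(G_2))$ if and only if, up to isomorphism, $G_2$ can be obtained from $G_1$ by a finite sequence of simple local complementations. -/

import Mathlib

/-- A looped simple graph on `V`: edges are determined by their incidences, and loops are allowed.
`Adj v w` for `v ≠ w` says that `v` and `w` are joined by an edge; `Adj v v` says that `v` is
looped. -/
@[ext]
structure LoopedSimpleGraph (V : Type*) where
  Adj : V → V → Prop
  symm : ∀ v w, Adj v w → Adj w v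

/-- The three kinds of columns of `(I ∣ A(G) ∣ I + A(G))`. -/
inductive ColumnKind : Type
  | phi
  | chi
  | psi
  deriving DecidableEq

instance : Fintype ColumnKind where
  elems := {.phi, .chi, .psi}
  complete x := by cases x <;> simp

/-- The binary matroid on the finite set `S` represented by a matrix over `GF(2)` with columns
indexed by `S`: a set of column indices is independent iff the corresponding family of columns is
linearly independent. -/
def binaryMatroid {R S : Type*} [Finite S] (A : Matrix R S (ZMod 2)) : Matroid S :=
  (IndepMatroid.ofFinite (E := Set.univ) Set.finite_univ
    (fun I => LinearIndepOn (ZMod 2) A.col I)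
    (linearIndepOn_empty _ _)
    (fun _ _ hJ hIJ => hJ.mono hIJ)
    (by
      intro I J hI hJ hlt
      by_contra! hcon
      have hsub : A.col '' J ⊆ Submodule.span (ZMod 2) (A.col '' I) := by
        rintro _ ⟨e, he, rfl⟩
        by_cases heI : e ∈ I
        · exact Submodule.subset_span ⟨e, heI, rfl⟩
        · by_contra hns
          exact hcon e he heI (hI.insert hns)
      have hle : Submodule.span (ZMod 2) (A.col '' J) ≤ Submodule.span (ZMod 2) (A.col '' I) :=
        Submodule.span_le.2 hsub
      have hfr : ∀ K : Set S, LinearIndepOn (ZMod 2) A.col K →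
          Module.finrank (ZMod 2) (Submodule.span (ZMod 2) (A.col '' K)) = K.ncard := by
        intro K hK
        have : Fintype K := Fintype.ofFinite K
        have h := finrank_span_eq_card hK.linearIndependent
        rw [← Set.image_eq_range] at h
        rw [h, Set.ncard_eq_toFinset_card', Set.toFinset_card]
      have : FiniteDimensional (ZMod 2) (Submodule.span (ZMod 2) (A.col '' I)) :=
        FiniteDimensional.span_of_finite _ (Set.toFinite _)
      have h := Submodule.finrank_mono hle
      rw [hfr I hI, hfr J hJ] at h
      omega)
    (fun _ _ => Set.subset_univ _)).matroid

/-- For matroids whose ground sets are all of `S` and `T`, as is the case for `binaryMatroid`: the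
bijection `e` is an isomorphism from `M` to `N`, i.e. it carries `M` to `N`. -/
def IsMatroidIso {S T : Type*} (M : Matroid S) (N : Matroid T) (e : S ≃ T) : Prop :=
  M.mapEquiv e = N

namespace LoopedSimpleGraph

variable {V V₁ V₂ : Type*}

/-- A simple graph is a looped simple graph without loops. -/
def IsSimple (G : LoopedSimpleGraph V) : Prop := ∀ v, ¬ G.Adj v v

/-- The open neighborhood `N(v)`; it never contains `v`. -/
def openNeighborhood (G : LoopedSimpleGraph V) (v : V) : Set V := {w | w ≠ v ∧ G.Adj v w}

open Classical in
/-- The adjacency matrix `A(G)` over `GF(2)`; diagonal entries record loops. -/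
noncomputable def adjMatrix (G : LoopedSimpleGraph V) : Matrix V V (ZMod 2) :=
  Matrix.of fun v w => if G.Adj v w then 1 else 0

open Classical in
/-- The matrix `IAS(G) = (I ∣ A(G) ∣ I + A(G))`. Its columns are indexed by `W(G) = V × {φ, χ, ψ}`:
the columns `(v, φ)`, `(v, χ)`, `(v, ψ)` are the `v`-columns of `I`, `A(G)`, `I + A(G)`. -/
noncomputable def iasMatrix (G : LoopedSimpleGraph V) : Matrix V (V × ColumnKind) (ZMod 2) :=
  Matrix.of fun u x =>
    match x.2 with
    | .phi => (1 : Matrix V V (ZMod 2)) u x.1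
    | .chi => G.adjMatrix u x.1
    | .psi => (1 + G.adjMatrix : Matrix V V (ZMod 2)) u x.1

/-- The isotropic matroid `M(IAS(G))`. -/
noncomputable def isotropicMatroid [Finite V] (G : LoopedSimpleGraph V) :
    Matroid (V × ColumnKind) :=
  binaryMatroid G.iasMatrix

/-- A bijection `W(G₁) → W(G₂)` is compatible with the canonical partitions into triples
`{v_φ, v_χ, v_ψ}`: it induces a bijection `b` of the vertex sets, and maps the triple of `v` to the
triple of `b v` by a permutation `f v` of the symbols. -/
def IsCompatible (e : V₁ × ColumnKind ≃ V₂ × ColumnKind) : Prop :=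
  ∃ (b : V₁ ≃ V₂) (f : V₁ → Equiv.Perm ColumnKind), ∀ v i, e (v, i) = (b v, f v i)

/-- Loop complementation at `v`: reverse the loop status of `v`. -/
def loopComplement (G : LoopedSimpleGraph V) (v : V) : LoopedSimpleGraph V where
  Adj a b := Xor (G.Adj a b) (a = b ∧ a = v)
  symm a b h := by
    have := G.symm a b
    have := G.symm b a
    grind [xor_def]

/-- The simple local complement `G_s^v`: complement all adjacencies between distinct elements of
the open neighborhood of `v`. -/
def simpleLocalComplement (G : LoopedSimpleGraph V) (v : V) : LoopedSimpleGraph V where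
  Adj a b := Xor (G.Adj a b) (a ≠ b ∧ a ∈ G.openNeighborhood v ∧ b ∈ G.openNeighborhood v)
  symm a b h := by
    have := G.symm a b
    have := G.symm b a
    grind [xor_def]

/-- The non-simple local complement `G_ns^v`: obtained from `G_s^v` by complementing the loop status
of each element of the open neighborhood of `v`. -/
def nonsimpleLocalComplement (G : LoopedSimpleGraph V) (v : V) : LoopedSimpleGraph V where
  Adj a b := Xor ((G.simpleLocalComplement v).Adj a b) (a = b ∧ a ∈ G.openNeighborhood v)
  symm a b h := by
    have := (G.simpleLocalComplement v).symm a b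
    have := (G.simpleLocalComplement v).symm b a
    grind [xor_def]

/-- `H` arises from `G` by one local complementation (simple or non-simple) or one loop
complementation. -/
inductive ComplementStep : LoopedSimpleGraph V → LoopedSimpleGraph V → Prop
  | simpleLocal (G : LoopedSimpleGraph V) (v : V) : ComplementStep G (G.simpleLocalComplement v)
  | nonsimpleLocal (G : LoopedSimpleGraph V) (v : V) :
      ComplementStep G (G.nonsimpleLocalComplement v)
  | loop (G : LoopedSimpleGraph V) (v : V) : ComplementStep G (G.loopComplement v)

/-- `H` arises from `G` by one simple local complementation. -/
inductive SimpleLocalStep : LoopedSimpleGraph V → LoopedSimpleGraph V → Prop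
  | simpleLocal (G : LoopedSimpleGraph V) (v : V) : SimpleLocalStep G (G.simpleLocalComplement v)

/-- Up to isomorphism, `G₂` can be obtained from `G₁` by a finite (possibly empty) sequence of
operations, each of them a step of the relation `step`. -/
def ObtainableUpToIso (step : LoopedSimpleGraph V₁ → LoopedSimpleGraph V₁ → Prop)
    (G₁ : LoopedSimpleGraph V₁) (G₂ : LoopedSimpleGraph V₂) : Prop :=
  ∃ H : LoopedSimpleGraph V₁, Relation.ReflTransGen step G₁ H ∧ Nonempty (H.Adj ≃r G₂.Adj)

end LoopedSimpleGraph

/-! ### Binary matroids and their cycle spaces -/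

open scoped Matrix

/-! A binary matroid is determined by the kernel of its matrix, its cycle space, so an isomorphism
is a bijection of columns carrying one cycle space to the other (`isMatroidIso_iff`).

Part 1: the cycle space is totally isotropic for the form that sums over triples the symplectic form
on GF(2)³ modulo (1,1,1) (`cycleSpace_isotropic`). If an isomorphism `e` breaks some triple, it is
composed with an automorphism that makes more triples go to triples
(`CarriesCycles.exists_improvement`). Either two elements of a triple share a target triple with a
third from elsewhere, and a swap repairs this, or all broken triples are spread over three targets.
In the latter case isotropy makes the incidences of source and target triples contain a `K₄,₄` minus
a perfect matching (`exists_crown`), and transposing this 4×4 pattern is an automorphism.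

Part 2: loop complementation exchanges χ and ψ at a vertex; non-simple local complementation is a
pivot exchanging φ with another column of the same triple. Conversely, a compatible isomorphism
permutes each triple, and pivots reduce the number of vertices whose φ is moved; when there are
none, the graphs differ only in loops (`reflTransGen_complementStep_of_carriesCycles`).

Part 3: deleting loops turns every step into a simple local complementation or into nothing
(`reflTransGen_removeLoops`). -/

theorem binaryMatroid_indep_iff {R S : Type*} [Finite S] (A : Matrix R S (ZMod 2)) (I : Set S) :
    (binaryMatroid A).Indep I ↔ LinearIndepOn (ZMod 2) A.col I :=
  Iff.rfl

theorem linearIndepOn_col_iff {R S : Type*} [Fintype S] (A : Matrix R S (ZMod 2)) (I : Set S) :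
    LinearIndepOn (ZMod 2) A.col I ↔
      ∀ f : S → ZMod 2, A *ᵥ f = 0 → Function.support f ⊆ I → f = 0 := by
  classical
  have key : ∀ f : S → ZMod 2, A *ᵥ f = ∑ i, f i • A.col i := by
    intro f
    ext r
    simp [Matrix.mulVec, dotProduct, mul_comm]
  rw [linearIndepOn_iff]
  constructor
  · intro h f hf hs
    have := h (Finsupp.equivFunOnFinite.symm f) (by
      simpa [Finsupp.mem_supported] using hs) (by
      rw [Finsupp.linearCombination_apply, Finsupp.sum_fintype _ _ (by simp)]
      simpa [key] using hf)
    ext s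
    simpa using DFunLike.congr_fun this s
  · intro h l hl h0
    have := h l (by
      rw [Finsupp.linearCombination_apply, Finsupp.sum_fintype _ _ (by simp)] at h0
      rw [key, h0]) (by simpa [Finsupp.mem_supported] using hl)
    exact DFunLike.coe_injective this

theorem ZMod.eq_of_support_eq {S : Type*} {f g : S → ZMod 2}
    (h : Function.support f = Function.support g) : f = g := by
  have key : ∀ a b : ZMod 2, (a ≠ 0 ↔ b ≠ 0) → a = b := by decide
  ext s
  exact key _ _ (Set.ext_iff.1 h s)

/-- A binary vector space is determined by the sets containing no nonzero support. -/
theorem ZMod.submodule_le_of_support {S : Type*} [Finite S] {K L : Submodule (ZMod 2) (S → ZMod 2)}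
    (h : ∀ I : Set S, (∀ f ∈ K, Function.support f ⊆ I → f = 0) ↔
      (∀ f ∈ L, Function.support f ⊆ I → f = 0)) : K ≤ L := by
  suffices H : ∀ n, ∀ f ∈ K, (Function.support f).ncard = n → f ∈ L from
    fun f hf => H _ f hf rfl
  intro n
  induction n using Nat.strong_induction_on with
  | _ n ih =>
    intro f hf hn
    by_cases hf0 : f = 0
    · simp [hf0]
    -- A nonzero `g ∈ K` of least support below `f`. The hypothesis yields a nonzero `k ∈ L` below
    -- `g` and then a nonzero `l ∈ K` below `k`; minimality makes the three supports equal, so `g =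
    -- k`.
    obtain ⟨g, ⟨hgK, hg0, hgf⟩, hmin⟩ := Set.exists_min_image
      {g | g ∈ K ∧ g ≠ 0 ∧ Function.support g ⊆ Function.support f}
      (fun g => (Function.support g).ncard) (Set.toFinite _) ⟨f, hf, hf0, subset_rfl⟩
    have hgL : g ∈ L := by
      have hdep := mt (h (Function.support g)).2 fun H => hg0 (H g hgK subset_rfl)
      push Not at hdep
      obtain ⟨k, hkL, hkg, hk0⟩ := hdep
      have hdep' := mt (h (Function.support k)).1 fun H => hk0 (H k hkL subset_rfl)
      push Not at hdep'
      obtain ⟨l, hlK, hlk, hl0⟩ := hdep'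
      have hle := hmin l ⟨hlK, hl0, (hlk.trans hkg).trans hgf⟩
      have hlg := Set.eq_of_subset_of_ncard_le (hlk.trans hkg) hle
      have hkg' : k = g := ZMod.eq_of_support_eq (hkg.antisymm (hlg ▸ hlk))
      exact hkg' ▸ hkL
    -- Both vectors equal 1 on the support of `g`, so subtraction removes it from the support of
    -- `f`.
    have hsub : f - g ∈ L := by
      refine ih _ ?_ (f - g) (K.sub_mem hf hgK) rfl
      rw [← hn]
      obtain ⟨s, hs⟩ := Function.support_nonempty_iff.2 hg0
      have hval : ∀ a : ZMod 2, a ≠ 0 → a = 1 := by decide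
      refine Set.ncard_lt_ncard (Set.ssubset_iff_of_subset ?_ |>.2 ⟨s, hgf hs, ?_⟩)
      · intro t ht
        by_contra htf
        have hgt : t ∉ Function.support g := fun H => htf (hgf H)
        simp only [Function.mem_support, not_not] at htf hgt
        simp [htf, hgt] at ht
      · simp [hval _ hs, hval _ (hgf hs)]
    simpa using L.add_mem hsub hgL

theorem isMatroidIso_binaryMatroid_iff {R R' S T : Type*} [Fintype S] [Fintype T]
    (A : Matrix R S (ZMod 2)) (B : Matrix R' T (ZMod 2)) (e : S ≃ T) :
    IsMatroidIso (binaryMatroid A) (binaryMatroid B) e ↔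
      ∀ f : T → ZMod 2, B *ᵥ f = 0 ↔ A *ᵥ (f ∘ e) = 0 := by
  -- The kernel of `A` is transported along `e`, so that both kernels lie in `T → ZMod 2`.
  let K := (LinearMap.ker A.mulVecLin).comap (LinearMap.funLeft (ZMod 2) (ZMod 2) e)
  let L := LinearMap.ker B.mulVecLin
  have hK : ∀ f, f ∈ K ↔ A *ᵥ (f ∘ e) = 0 := fun f => by
    simp [K, LinearMap.funLeft, Function.comp_def]
  have hL : ∀ f, f ∈ L ↔ B *ᵥ f = 0 := fun f => by simp [L]
  have hiso : IsMatroidIso (binaryMatroid A) (binaryMatroid B) e ↔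
      ∀ I : Set T, (∀ f ∈ K, Function.support f ⊆ I → f = 0) ↔
        (∀ f ∈ L, Function.support f ⊆ I → f = 0) := by
    have h1 : ∀ I : Set T, ((binaryMatroid A).mapEquiv e).Indep I ↔
        ∀ f ∈ K, Function.support f ⊆ I → f = 0 := by
      intro I
      rw [Matroid.mapEquiv_indep_iff, binaryMatroid_indep_iff, linearIndepOn_col_iff]
      constructor
      · intro h f hf hs
        have := h (f ∘ e) ((hK f).1 hf) (by
          intro s hs'
          exact ⟨e s, hs hs', by simp⟩)
        ext t
        simpa using congrFun this (e.symm t)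
      · intro h f hf hs
        have := h (f ∘ e.symm) ((hK _).2 (by simpa [Function.comp_assoc] using hf)) (by
          intro t ht
          obtain ⟨u, hu, hut⟩ := hs (show e.symm t ∈ Function.support f from ht)
          rwa [← e.symm.injective hut])
        ext s
        simpa using congrFun this (e s)
    have h2 : ∀ I : Set T, (binaryMatroid B).Indep I ↔
        ∀ f ∈ L, Function.support f ⊆ I → f = 0 := by
      intro I
      simp only [binaryMatroid_indep_iff, linearIndepOn_col_iff, hL]
    simp only [← h1, ← h2]
    constructor
    · intro h I
      rw [← h]
    · intro h
      exact Matroid.ext_indep (show e '' Set.univ = Set.univ by simp) fun I _ => h I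
  rw [hiso]
  constructor
  · intro h f
    have : K = L := le_antisymm (ZMod.submodule_le_of_support h)
      (ZMod.submodule_le_of_support fun I => (h I).symm)
    rw [← hK, ← hL, this]
  · intro h I
    have : K = L := by
      ext f
      rw [hK, hL, h]
    rw [this]

/-! ### The cycle space of the isotropic matroid -/

namespace LoopedSimpleGraph

open ColumnKind

variable {V V₁ V₂ V₃ : Type*}

/-- The cycle space of the isotropic matroid: the linear relations among the columns of `IAS(G)`. -/
noncomputable def cycleSpace [Fintype V] (G : LoopedSimpleGraph V) :
    Submodule (ZMod 2) (V × ColumnKind → ZMod 2) :=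
  LinearMap.ker G.iasMatrix.mulVecLin

theorem sum_columnKind {M : Type*} [AddCommMonoid M] (f : ColumnKind → M) :
    ∑ k, f k = f phi + f chi + f psi := by
  have : (Finset.univ : Finset ColumnKind) = {phi, chi, psi} := by decide
  rw [this]
  simp [add_assoc]

theorem mem_cycleSpace_iff [Fintype V] (G : LoopedSimpleGraph V) (f : V × ColumnKind → ZMod 2) :
    f ∈ G.cycleSpace ↔ ∀ u, f (u, phi) + f (u, psi) +
      ∑ v, G.adjMatrix u v * (f (v, chi) + f (v, psi)) = 0 := by
  classical
  rw [cycleSpace, LinearMap.mem_ker, Matrix.mulVecLin_apply, funext_iff]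
  refine forall_congr' fun u => ?_
  have : (G.iasMatrix *ᵥ f) u = f (u, phi) + f (u, psi) +
      ∑ v, G.adjMatrix u v * (f (v, chi) + f (v, psi)) := by
    simp only [Matrix.mulVec, dotProduct, Fintype.sum_prod_type, sum_columnKind, iasMatrix,
      Matrix.of_apply, Matrix.add_apply, Finset.sum_add_distrib, mul_add, add_mul,
      Matrix.one_apply, ite_mul, one_mul, zero_mul, Finset.sum_ite_eq, Finset.mem_univ, if_true]
    ring
  rw [this, Pi.zero_apply]

/-- The bijection `e` carries the cycle space of `G` to that of `H`. -/
def CarriesCycles [Fintype V₁] [Fintype V₂] (G : LoopedSimpleGraph V₁) (H : LoopedSimpleGraph V₂)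
    (e : V₁ × ColumnKind ≃ V₂ × ColumnKind) : Prop :=
  ∀ f, f ∈ H.cycleSpace ↔ f ∘ e ∈ G.cycleSpace

theorem isMatroidIso_iff [Fintype V₁] [Fintype V₂] {G : LoopedSimpleGraph V₁}
    {H : LoopedSimpleGraph V₂} {e : V₁ × ColumnKind ≃ V₂ × ColumnKind} :
    IsMatroidIso G.isotropicMatroid H.isotropicMatroid e ↔ CarriesCycles G H e :=
  isMatroidIso_binaryMatroid_iff _ _ _

section Carries

variable [Fintype V] [Fintype V₁] [Fintype V₂] [Fintype V₃] {G : LoopedSimpleGraph V₁}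
  {H : LoopedSimpleGraph V₂} {K : LoopedSimpleGraph V₃}

theorem CarriesCycles.refl (G : LoopedSimpleGraph V) : CarriesCycles G G (Equiv.refl _) :=
  fun _ => Iff.rfl

theorem CarriesCycles.symm {e : V₁ × ColumnKind ≃ V₂ × ColumnKind} (h : CarriesCycles G H e) :
    CarriesCycles H G e.symm := by
  intro f
  rw [h, Function.comp_assoc, Equiv.symm_comp_self, Function.comp_id]

theorem CarriesCycles.trans {e : V₁ × ColumnKind ≃ V₂ × ColumnKind}
    {e' : V₂ × ColumnKind ≃ V₃ × ColumnKind} (h : CarriesCycles G H e)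
    (h' : CarriesCycles H K e') : CarriesCycles G K (e.trans e') := by
  intro f
  rw [h', h]
  rfl

theorem carriesCycles_of_relIso (φ : G.Adj ≃r H.Adj) :
    CarriesCycles G H (Equiv.prodCongr φ.toEquiv (Equiv.refl _)) := by
  intro f
  rw [mem_cycleSpace_iff, mem_cycleSpace_iff, ← φ.toEquiv.forall_congr_right]
  refine forall_congr' fun u => ?_
  rw [← φ.toEquiv.sum_comp]
  have hadj : ∀ u v, H.adjMatrix (φ.toEquiv u) (φ.toEquiv v) = G.adjMatrix u v := by
    intro u v
    simp only [adjMatrix, Matrix.of_apply]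
    congr 1
    exact propext φ.map_rel_iff
  simp only [hadj]
  rfl

end Carries

/-! ### Complementations as isomorphisms -/

section Steps

open scoped Classical

/-- Change of a column index that fixes the vertex. -/
abbrev permuteKinds (f : V → Equiv.Perm ColumnKind) : V × ColumnKind ≃ V × ColumnKind :=
  Equiv.prodShear (Equiv.refl V) f

theorem permuteKinds_apply (f : V → Equiv.Perm ColumnKind) (v : V) (k : ColumnKind) :
    permuteKinds f (v, k) = (v, f v k) :=
  rfl

theorem permuteKinds_trans (f g : V → Equiv.Perm ColumnKind) :
    (permuteKinds f).trans (permuteKinds g) = permuteKinds (fun v => g v * f v) :=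
  rfl

theorem permuteKinds_symm (f : V → Equiv.Perm ColumnKind) :
    (permuteKinds f).symm = permuteKinds (fun v => (f v)⁻¹) :=
  rfl

/-- Changing the loop at `v` adds the unit vector of `v` to the χ and ψ columns, which exchanges the
two. -/
theorem carriesCycles_loopComplement [Fintype V] (G : LoopedSimpleGraph V) (v : V) :
    CarriesCycles G (G.loopComplement v)
      (permuteKinds (Pi.mulSingle v (Equiv.swap chi psi))) := by
  intro f
  rw [mem_cycleSpace_iff, mem_cycleSpace_iff]
  refine forall_congr' fun u => ?_
  have hadj : ∀ w, (G.loopComplement v).adjMatrix u w =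
      G.adjMatrix u w + if w = v then if u = v then 1 else 0 else 0 := by
    intro w
    simp only [adjMatrix, Matrix.of_apply, loopComplement, xor_def]
    by_cases h1 : G.Adj u w <;> by_cases h2 : w = v <;> by_cases h3 : u = v <;>
      simp_all <;> grind
  have hsum : ∀ w, f (permuteKinds (Pi.mulSingle v (Equiv.swap chi psi)) (w, chi)) +
      f (permuteKinds (Pi.mulSingle v (Equiv.swap chi psi)) (w, psi)) =
      f (w, chi) + f (w, psi) := by
    intro w
    by_cases h : w = v
    · subst h
      simp [permuteKinds_apply, add_comm]
    · simp [permuteKinds_apply, h]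
  simp only [Function.comp_apply, hsum, hadj, add_mul, Finset.sum_add_distrib, ite_mul, zero_mul,
    one_mul, Finset.sum_ite_eq', Finset.mem_univ, if_true]
  by_cases h : u = v
  · subst h
    simp only [permuteKinds_apply, Pi.mulSingle_eq_same, Equiv.swap_apply_right, if_true]
    rw [Equiv.swap_apply_of_ne_of_ne (by decide) (by decide)]
    have h2 : f (u, psi) + f (u, psi) = 0 := CharTwo.add_self_eq_zero _
    refine Eq.congr ?_ rfl
    linear_combination h2
  · simp [permuteKinds_apply, h]

/-- The kind of the column at `v` whose entry in row `v` is `1`, other than `φ`. -/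
noncomputable def pivotKind (G : LoopedSimpleGraph V) (v : V) : ColumnKind :=
  if G.Adj v v then chi else psi

/-- The kind of the column at `v` that is the indicator of the open neighborhood of `v`. -/
noncomputable def nbrKind (G : LoopedSimpleGraph V) (v : V) : ColumnKind :=
  if G.Adj v v then psi else chi

theorem adjMatrix_nonsimpleLocalComplement (G : LoopedSimpleGraph V) (v a b : V) :
    (G.nonsimpleLocalComplement v).adjMatrix a b = G.adjMatrix a b +
      (if a ∈ G.openNeighborhood v then 1 else 0) * (if b ∈ G.openNeighborhood v then 1 else 0) := by
  simp only [adjMatrix, Matrix.of_apply, nonsimpleLocalComplement, simpleLocalComplement, xor_def]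
  by_cases h1 : G.Adj a b <;> by_cases h2 : a ∈ G.openNeighborhood v <;>
    by_cases h3 : b ∈ G.openNeighborhood v <;> by_cases h4 : a = b <;>
      simp_all <;> decide

/-- The pivot column is the indicator of `N(v) ∪ {v}`. Adding row `v` to the rows of `N(v)`
exchanges it with the identity column of `v` and complements all entries of `A(G)` indexed by `N(v)
× N(v)`, diagonal included. -/
theorem carriesCycles_nonsimpleLocalComplement [Fintype V] (G : LoopedSimpleGraph V) (v : V) :
    CarriesCycles G (G.nonsimpleLocalComplement v)
      (permuteKinds (Pi.mulSingle v (Equiv.swap phi (G.pivotKind v)))) := by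
  intro f
  rw [mem_cycleSpace_iff, mem_cycleSpace_iff]
  set e := permuteKinds (Pi.mulSingle v (Equiv.swap phi (G.pivotKind v))) with he
  set n : V → ZMod 2 := fun u => if u ∈ G.openNeighborhood v then 1 else 0 with hn
  have hnv : n v = 0 := by simp [n, openNeighborhood]
  have hAn : ∀ u, u ≠ v → G.adjMatrix u v = n u := by
    intro u hu
    have : G.Adj u v ↔ G.Adj v u := ⟨G.symm _ _, G.symm _ _⟩
    simp [adjMatrix, n, openNeighborhood, hu, this]
  have hAn' : ∀ u, G.adjMatrix v u = n u + if u = v then G.adjMatrix v v else 0 := by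
    intro u
    by_cases hu : u = v
    · subst hu; simp [hnv]
    · simp [adjMatrix, n, openNeighborhood, hu]
  have hone : ∀ u, u ≠ v → ∀ k, e (u, k) = (u, k) := by
    intro u hu k
    simp [e, permuteKinds_apply, hu]
  set p := f (v, phi) + f (v, psi) with hp
  set q : V → ZMod 2 := fun w => f (w, chi) + f (w, psi) with hq
  set α := G.adjMatrix v v with hα
  have hval : (α = 0 ∧ G.pivotKind v = psi) ∨ (α = 1 ∧ G.pivotKind v = chi) := by
    by_cases h : G.Adj v v <;> simp [α, adjMatrix, pivotKind, h]
  have two : ∀ x : ZMod 2, x + x = 0 := CharTwo.add_self_eq_zero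
  have hev : ∀ k, e (v, k) = (v, Equiv.swap phi (G.pivotKind v) k) := by
    intro k
    simp [e, permuteKinds_apply]
  have hpv : f (e (v, phi)) + f (e (v, psi)) = p + α * (p + q v) := by
    rcases hval with ⟨h1, h2⟩ | ⟨h1, h2⟩ <;> rw [h1, hev, hev, h2]
    · simp [p, add_comm]
    · rw [Equiv.swap_apply_left, Equiv.swap_apply_of_ne_of_ne (by decide) (by decide)]
      linear_combination -two p
  have hqv : ∀ w, f (e (w, chi)) + f (e (w, psi)) =
      q w + if w = v then p + α * q v else 0 := by
    intro w
    by_cases hw : w = v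
    · subst hw
      rcases hval with ⟨h1, h2⟩ | ⟨h1, h2⟩ <;> rw [h1, hev, hev, h2]
      · rw [Equiv.swap_apply_right, Equiv.swap_apply_of_ne_of_ne (by decide) (by decide)]
        simp only [if_true, p, q]
        linear_combination -two (f (w, psi))
      · rw [Equiv.swap_apply_right, Equiv.swap_apply_of_ne_of_ne (by decide) (by decide)]
        simp only [if_true]
        linear_combination -two (q w)
    · simp [hone w hw, hw, q]
  have hC : ∀ u, ∑ w, (G.nonsimpleLocalComplement v).adjMatrix u w * (f (w, chi) + f (w, psi)) =
      ∑ w, G.adjMatrix u w * q w + n u * ∑ w, n w * q w := by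
    intro u
    simp only [adjMatrix_nonsimpleLocalComplement, add_mul, Finset.sum_add_distrib, Finset.mul_sum,
      mul_assoc]
    rfl
  have hD : ∀ u, ∑ w, G.adjMatrix u w * ((f ∘ e) (w, chi) + (f ∘ e) (w, psi)) =
      ∑ w, G.adjMatrix u w * q w + G.adjMatrix u v * (p + α * q v) := by
    intro u
    simp only [Function.comp_apply, hqv, mul_add, Finset.sum_add_distrib, mul_ite, mul_zero,
      Finset.sum_ite_eq', Finset.mem_univ, if_true]
  have hE : ∑ w, G.adjMatrix v w * q w = ∑ w, n w * q w + α * q v := by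
    simp only [hAn', add_mul, Finset.sum_add_distrib, ite_mul, zero_mul, Finset.sum_ite_eq',
      Finset.mem_univ, if_true]
  simp only [hC, hD]
  -- `C u` is the equation of the new graph at row `u`. By `hmain` the old equation is `C u + n u *
  -- C v`, an invertible row operation because `n v = 0`.
  set C : V → ZMod 2 := fun u => f (u, phi) + f (u, psi) +
    (∑ w, G.adjMatrix u w * q w + n u * ∑ w, n w * q w) with hCdef
  have hCv : C v = p + ∑ w, n w * q w + α * q v := by
    simp only [C, hE, hnv, zero_mul]
    ring
  have hmain : ∀ u, f (e (u, phi)) + f (e (u, psi)) + (∑ w, G.adjMatrix u w * q w +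
      G.adjMatrix u v * (p + α * q v)) = C u + n u * C v := by
    intro u
    by_cases hu : u = v
    · subst hu
      rw [hpv, hE, hCv, hnv]
      have : α * α = α := by rcases hval with ⟨h1, -⟩ | ⟨h1, -⟩ <;> simp [h1]
      linear_combination q u * this + two (α * p) + two (α * q u)
    · rw [hone u hu, hone u hu, hAn u hu, hCv]
      simp only [C]
      linear_combination (-1 : ZMod 2) * two (n u * ∑ w, n w * q w)
  constructor
  · intro h u
    have h' : ∀ u, C u = 0 := h
    refine (hmain u).trans ?_
    simp [h']
  · intro h
    have h' : ∀ u, C u + n u * C v = 0 := fun u => (hmain u).symm.trans (h u)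
    have hv : C v = 0 := by simpa [hnv] using h' v
    intro u
    have := h' u
    rw [hv, mul_zero, add_zero] at this
    exact this

end Steps

end LoopedSimpleGraph

/-! ### From compatible isomorphisms to sequences of complementations -/

namespace LoopedSimpleGraph

open ColumnKind Relation

variable {V V₁ V₂ : Type*}

section Reach

open scoped Classical

/-- Graphs which agree up to loops differ by loop complementations. -/
theorem reflTransGen_loopComplement [Fintype V] (G H : LoopedSimpleGraph V)
    (h : ∀ a b, a ≠ b → (G.Adj a b ↔ H.Adj a b)) :
    ReflTransGen (fun G G' : LoopedSimpleGraph V => ∃ v, G' = G.loopComplement v) G H := by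
  induction hn : (Finset.univ.filter fun v => ¬ (G.Adj v v ↔ H.Adj v v)).card using
    Nat.strong_induction_on generalizing G with
  | _ n ih =>
    by_cases hex : ∃ v, ¬ (G.Adj v v ↔ H.Adj v v)
    · obtain ⟨v, hv⟩ := hex
      refine ReflTransGen.head ⟨v, rfl⟩ (ih _ ?_ (G.loopComplement v) ?_ rfl)
      · rw [← hn]
        refine Finset.card_lt_card (Finset.ssubset_iff_of_subset ?_ |>.2 ⟨v, ?_, ?_⟩)
        · intro w
          by_cases hw : w = v
          · subst hw; simp [hv]
          · simp [loopComplement, xor_def, hw]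
        · simp [hv]
        · simp only [Finset.mem_filter, Finset.mem_univ, true_and, loopComplement, xor_def]
          tauto
      · intro a b hab
        simp [loopComplement, xor_def, hab, h a b hab]
    · push Not at hex
      have : G = H := by
        ext a b
        by_cases hab : a = b
        · subst hab; exact hex a
        · exact h a b hab
      rw [this]

theorem exists_carriesCycles_of_reflTransGen_loopComplement [Fintype V] {G H : LoopedSimpleGraph V}
    (h : ReflTransGen (fun G G' : LoopedSimpleGraph V => ∃ v, G' = G.loopComplement v) G H) :
    ∃ e, CarriesCycles G H e := by
  induction h with
  | refl => exact ⟨_, CarriesCycles.refl _⟩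
  | tail _ h ih =>
    obtain ⟨v, rfl⟩ := h
    obtain ⟨e, he⟩ := ih
    exact ⟨_, he.trans (carriesCycles_loopComplement _ v)⟩

/-- The simple and the non-simple local complement differ only in loops, so the simple one is a
pivot followed by loop complementations. -/
theorem exists_carriesCycles_of_complementStep [Fintype V] {G H : LoopedSimpleGraph V}
    (h : ComplementStep G H) : ∃ e, CarriesCycles G H e := by
  cases h with
  | simpleLocal v =>
    obtain ⟨e, he⟩ := exists_carriesCycles_of_reflTransGen_loopComplement
      (reflTransGen_loopComplement (G.nonsimpleLocalComplement v) (G.simpleLocalComplement v)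
        fun a b hab => by simp [nonsimpleLocalComplement, xor_def, hab])
    exact ⟨_, (carriesCycles_nonsimpleLocalComplement G v).trans he⟩
  | nonsimpleLocal v => exact ⟨_, carriesCycles_nonsimpleLocalComplement G v⟩
  | loop v => exact ⟨_, carriesCycles_loopComplement G v⟩

theorem exists_carriesCycles_of_obtainable [Fintype V₁] [Fintype V₂] {G₁ : LoopedSimpleGraph V₁}
    {G₂ : LoopedSimpleGraph V₂} (h : ObtainableUpToIso ComplementStep G₁ G₂) :
    ∃ e, CarriesCycles G₁ G₂ e := by
  obtain ⟨H, hH, ⟨φ⟩⟩ := h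
  have : ∃ e, CarriesCycles G₁ H e := by
    clear φ
    induction hH with
    | refl => exact ⟨_, CarriesCycles.refl _⟩
    | tail _ h ih =>
      obtain ⟨e, he⟩ := ih
      obtain ⟨e', he'⟩ := exists_carriesCycles_of_complementStep h
      exact ⟨_, he.trans he'⟩
  obtain ⟨e, he⟩ := this
  exact ⟨_, he.trans (carriesCycles_of_relIso φ)⟩

/-- The fundamental circuit of the neighborhood column at `v` with respect to the basis of
identity columns. -/
theorem nbr_mem_cycleSpace [Fintype V] (G : LoopedSimpleGraph V) (v : V) :
    (fun x : V × ColumnKind =>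
      if x = (v, G.nbrKind v) then 1 else
        if x.2 = phi ∧ x.1 ∈ G.openNeighborhood v then (1 : ZMod 2) else 0) ∈ G.cycleSpace := by
  rw [mem_cycleSpace_iff]
  intro u
  have hk : G.nbrKind v = chi ∨ G.nbrKind v = psi := by
    by_cases h : G.Adj v v <;> simp [nbrKind, h]
  have hsum : ∀ w, ((if ((w, chi) : V × ColumnKind) = (v, G.nbrKind v) then (1 : ZMod 2) else
        if (w, chi).2 = phi ∧ (w, chi).1 ∈ G.openNeighborhood v then (1 : ZMod 2) else 0) +
      (if ((w, psi) : V × ColumnKind) = (v, G.nbrKind v) then 1 else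
        if (w, psi).2 = phi ∧ (w, psi).1 ∈ G.openNeighborhood v then (1 : ZMod 2) else 0)) =
        if w = v then 1 else 0 := by
    intro w
    by_cases hw : w = v <;> rcases hk with h | h <;> simp [hw, h]
  simp only [hsum, mul_ite, mul_one, mul_zero, Finset.sum_ite_eq', Finset.mem_univ, if_true]
  have hsymm : G.Adj u v ↔ G.Adj v u := ⟨G.symm _ _, G.symm _ _⟩
  by_cases hu : u = v
  · subst hu
    by_cases h : G.Adj u u <;> simp [nbrKind, h, openNeighborhood, adjMatrix]
    decide
  · by_cases h : G.Adj v u <;> simp [openNeighborhood, adjMatrix, hu, h, hsymm]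
    decide

theorem eq_zero_of_mem_cycleSpace [Fintype V] {G : LoopedSimpleGraph V}
    {f : V × ColumnKind → ZMod 2} (hf : f ∈ G.cycleSpace)
    (h : ∀ v k, k ≠ phi → f (v, k) = 0) (v : V) : f (v, phi) = 0 := by
  have := (mem_cycleSpace_iff G f).1 hf v
  simpa [h _ chi (by decide), h _ psi (by decide)] using this

theorem CarriesCycles.nonsimpleLocalComplement [Fintype V] {G H : LoopedSimpleGraph V}
    {f : V → Equiv.Perm ColumnKind} (h : CarriesCycles G H (permuteKinds f)) (v : V) :
    CarriesCycles (G.nonsimpleLocalComplement v) H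
      (permuteKinds fun w => f w * (Pi.mulSingle v (Equiv.swap phi (G.pivotKind v)) :
        V → Equiv.Perm ColumnKind) w) := by
  have h' := (carriesCycles_nonsimpleLocalComplement G v).symm.trans h
  rw [permuteKinds_symm, permuteKinds_trans] at h'
  convert h' using 4 with w
  rw [← Pi.inv_apply, ← Pi.mulSingle_inv, Equiv.swap_inv]

/-- If every identity column is carried to an identity column, then the graphs agree up to
loops. -/
theorem CarriesCycles.adj_iff [Fintype V] {G H : LoopedSimpleGraph V}
    {f : V → Equiv.Perm ColumnKind} (h : CarriesCycles G H (permuteKinds f))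
    (hf : ∀ v, f v phi = phi) {a b : V} (hab : a ≠ b) : G.Adj a b ↔ H.Adj a b := by
  -- The image of the neighborhood circuit of `b` consists of identity columns and one further
  -- column at `b`. Row `a` of `H` then compares membership of `a` in the `G`-neighborhood of `b`
  -- with the entry of `A(H)` at `(a, b)`.
  have hcyc := h.symm _ |>.1 (nbr_mem_cycleSpace G b)
  have hf' : ∀ v k, (f v)⁻¹ k = phi ↔ k = phi := by
    intro v k
    rw [Equiv.Perm.inv_eq_iff_eq, hf]
  have hk : G.nbrKind b ≠ phi := by
    by_cases h : G.Adj b b <;> simp [nbrKind, h]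
  have hk' : f b (G.nbrKind b) = chi ∨ f b (G.nbrKind b) = psi := by
    have : f b (G.nbrKind b) ≠ phi := by
      rw [← hf b]
      exact fun h => hk ((f b).injective h)
    generalize f b (G.nbrKind b) = k at this ⊢
    cases k <;> simp_all
  have hsum : ∀ w k, (((fun x : V × ColumnKind =>
      if x = (b, G.nbrKind b) then 1 else
        if x.2 = phi ∧ x.1 ∈ G.openNeighborhood b then (1 : ZMod 2) else 0)) ∘
        (permuteKinds f).symm) (w, k) = if w = b ∧ k = f b (G.nbrKind b) then 1 else
        if k = phi ∧ w ∈ G.openNeighborhood b then 1 else 0 := by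
    intro w k
    rw [permuteKinds_symm, Function.comp_apply, permuteKinds_apply]
    simp only [hf', Prod.mk.injEq]
    by_cases hw : w = b
    · subst hw
      simp only [Equiv.Perm.inv_eq_iff_eq]
    · simp [hw]
  have := (mem_cycleSpace_iff H _).1 hcyc a
  simp only [hsum] at this
  have hq : ∀ w, ((if w = b ∧ chi = f b (G.nbrKind b) then (1 : ZMod 2) else
        if chi = phi ∧ w ∈ G.openNeighborhood b then 1 else 0) +
      (if w = b ∧ psi = f b (G.nbrKind b) then (1 : ZMod 2) else
        if psi = phi ∧ w ∈ G.openNeighborhood b then 1 else 0)) = if w = b then 1 else 0 := by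
    intro w
    by_cases hw : w = b <;> rcases hk' with h | h <;> simp [hw, h]
  simp only [hab, false_and, if_false, true_and, reduceCtorEq, add_zero] at this
  have hsymm : G.Adj b a ↔ G.Adj a b := ⟨G.symm _ _, G.symm _ _⟩
  by_cases h1 : G.Adj a b <;> by_cases h2 : H.Adj a b <;>
    simp_all [openNeighborhood, adjMatrix]

/-- Induction on the number of bad vertices, those with `f v phi ≠ phi`. -/
theorem reflTransGen_complementStep_of_carriesCycles [Fintype V] (G H : LoopedSimpleGraph V)
    (f : V → Equiv.Perm ColumnKind) (h : CarriesCycles G H (permuteKinds f)) :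
    ReflTransGen ComplementStep G H := by
  induction hn : (Finset.univ.filter fun v => f v phi ≠ phi).card using
    Nat.strong_induction_on generalizing G f with
  | _ n ih =>
    -- If the pivot column of a bad vertex goes to φ, a pivot there makes the vertex good and leaves
    -- the permutations at the others alone.
    have hpivot : ∀ (G : LoopedSimpleGraph V) (f : V → Equiv.Perm ColumnKind),
        CarriesCycles G H (permuteKinds f) →
        (Finset.univ.filter fun v => f v phi ≠ phi).card = n →
        (∃ v, f v phi ≠ phi ∧ f v (G.pivotKind v) = phi) → ReflTransGen ComplementStep G H := by
      rintro G f h hn ⟨v, hv, hv'⟩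
      refine ReflTransGen.head (.nonsimpleLocal G v)
        (ih _ ?_ _ _ (h.nonsimpleLocalComplement v) rfl)
      rw [← hn]
      refine Finset.card_lt_card (Finset.ssubset_iff_of_subset ?_ |>.2 ⟨v, ?_, ?_⟩)
      · intro w
        rw [Finset.mem_filter, Finset.mem_filter]
        by_cases hw : w = v
        · subst hw; simp [hv]
        · simp [hw]
      · simp [hv]
      · rw [Finset.mem_filter]
        simp [hv']
    by_cases hD : ∀ v, f v phi = phi
    · refine ReflTransGen.mono ?_ _ _
        (reflTransGen_loopComplement G H fun a b hab => h.adj_iff hD hab)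
      rintro G _ ⟨v, rfl⟩
      exact .loop G v
    by_cases hex : ∃ v, f v phi ≠ phi ∧ f v (G.pivotKind v) = phi
    · exact hpivot G f h hn hex
    push Not at hD hex
    have hnbr : ∀ v, f v phi ≠ phi → f v (G.nbrKind v) = phi := by
      intro v hv
      have hv' := hex v hv
      obtain ⟨k, hk⟩ := (f v).surjective phi
      by_cases hl : G.Adj v v <;> simp only [nbrKind, pivotKind, hl, if_true, if_false] at hv' ⊢ <;>
        cases k <;> first | exact hk | exact absurd hk hv | exact absurd hk hv'
    obtain ⟨v, hv⟩ := hD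
    -- A bad `v` has a bad neighbor: otherwise the neighborhood circuit of `v` would be carried to a
    -- nonzero cycle of identity columns only.
    obtain ⟨w, hw, hwv⟩ : ∃ w, f w phi ≠ phi ∧ w ∈ G.openNeighborhood v := by
      by_contra! hcon
      have hcyc := h.symm _ |>.1 (nbr_mem_cycleSpace G v)
      have hinv : (f v)⁻¹ phi = G.nbrKind v := by
        rw [Equiv.Perm.inv_eq_iff_eq, hnbr v hv]
      have := eq_zero_of_mem_cycleSpace hcyc (fun w k hk => by
        rw [permuteKinds_symm, Function.comp_apply, permuteKinds_apply]
        have h1 : ¬ ((w, (f w)⁻¹ k) = (v, G.nbrKind v)) := by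
          rintro h1
          obtain ⟨rfl, h1⟩ := Prod.mk.inj h1
          rw [← hinv] at h1
          exact hk ((f w)⁻¹.injective h1)
        have h2 : ¬ ((f w)⁻¹ k = phi ∧ w ∈ G.openNeighborhood v) := by
          rintro ⟨h2, h3⟩
          rw [Equiv.Perm.inv_eq_iff_eq] at h2
          refine hk (h2.trans ?_)
          by_contra h4
          exact hcon w h4 h3
        simp only [h1, h2, if_false]) v
      rw [permuteKinds_symm, Function.comp_apply, permuteKinds_apply, hinv] at this
      simp at this
    -- The pivot at `v` leaves the set of bad vertices unchanged but flips the loop at `w`; the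
    -- column of `w` sent to φ thereby becomes a pivot column, and `hpivot` applies.
    refine ReflTransGen.head (.nonsimpleLocal G v)
      (hpivot _ _ (h.nonsimpleLocalComplement v) ?_ ⟨w, ?_, ?_⟩)
    · rw [← hn]
      congr 1
      ext u
      rw [Finset.mem_filter, Finset.mem_filter]
      by_cases hu : u = v
      · subst hu; simp [hv, hex u hv]
      · simp [hu]
    · simp [hwv.1, hw]
    · have : (G.nonsimpleLocalComplement v).pivotKind w = G.nbrKind w := by
        by_cases hl : G.Adj w w <;>
          simp [pivotKind, nbrKind, nonsimpleLocalComplement, simpleLocalComplement, xor_def, hl,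
            hwv]
      rw [this]
      simp [hwv.1, hnbr w hw]

/-! ### Deleting loops, and transfer along vertex bijections -/

/-- The simple graph obtained by deleting all loops. -/
def removeLoops (G : LoopedSimpleGraph V) : LoopedSimpleGraph V where
  Adj a b := a ≠ b ∧ G.Adj a b
  symm _ _ h := ⟨h.1.symm, G.symm _ _ h.2⟩

theorem IsSimple.removeLoops_eq {G : LoopedSimpleGraph V} (h : G.IsSimple) : G.removeLoops = G := by
  ext a b
  refine ⟨fun h => h.2, fun hab => ⟨?_, hab⟩⟩
  rintro rfl
  exact h _ hab

theorem removeLoops_simpleLocalComplement (G : LoopedSimpleGraph V) (v : V) :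
    (G.simpleLocalComplement v).removeLoops = G.removeLoops.simpleLocalComplement v := by
  ext a b
  simp only [removeLoops, simpleLocalComplement, openNeighborhood, xor_def, Set.mem_ofPred_eq]
  by_cases hab : a = b <;> by_cases ha : a = v <;> by_cases hb : b = v <;> grind

theorem removeLoops_nonsimpleLocalComplement (G : LoopedSimpleGraph V) (v : V) :
    (G.nonsimpleLocalComplement v).removeLoops = (G.simpleLocalComplement v).removeLoops := by
  ext a b
  simp only [removeLoops, nonsimpleLocalComplement, xor_def]
  tauto

theorem removeLoops_loopComplement (G : LoopedSimpleGraph V) (v : V) :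
    (G.loopComplement v).removeLoops = G.removeLoops := by
  ext a b
  simp only [removeLoops, loopComplement, xor_def]
  tauto

theorem reflTransGen_removeLoops {G H : LoopedSimpleGraph V} (h : ReflTransGen ComplementStep G H) :
    ReflTransGen SimpleLocalStep G.removeLoops H.removeLoops := by
  induction h with
  | refl => exact .refl
  | tail _ h ih =>
    cases h with
    | simpleLocal v =>
      rw [removeLoops_simpleLocalComplement]
      exact ih.tail (.simpleLocal _ v)
    | nonsimpleLocal v =>
      rw [removeLoops_nonsimpleLocalComplement, removeLoops_simpleLocalComplement]
      exact ih.tail (.simpleLocal _ v)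
    | loop v => rwa [removeLoops_loopComplement]

/-- Pulling `G₂` back along the vertex bijection leaves only permutations inside the triples. -/
theorem obtainable_of_isCompatible [Fintype V₁] [Fintype V₂] {G₁ : LoopedSimpleGraph V₁}
    {G₂ : LoopedSimpleGraph V₂} {e : V₁ × ColumnKind ≃ V₂ × ColumnKind}
    (h : CarriesCycles G₁ G₂ e) (he : IsCompatible e) :
    ObtainableUpToIso ComplementStep G₁ G₂ := by
  obtain ⟨b, f, hbf⟩ := he
  let H : LoopedSimpleGraph V₁ := ⟨fun a c => G₂.Adj (b a) (b c), fun a c h => G₂.symm _ _ h⟩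
  let φ : H.Adj ≃r G₂.Adj := ⟨b, Iff.rfl⟩
  refine ⟨H, reflTransGen_complementStep_of_carriesCycles G₁ H f ?_, ⟨φ⟩⟩
  have h2 := h.trans (carriesCycles_of_relIso φ).symm
  convert h2 using 1
  ext1 ⟨v, k⟩
  rw [Equiv.trans_apply, hbf, Equiv.eq_symm_apply]
  rfl

theorem ObtainableUpToIso.removeLoops {G₁ : LoopedSimpleGraph V₁} {G₂ : LoopedSimpleGraph V₂}
    (h : ObtainableUpToIso ComplementStep G₁ G₂) (h₁ : G₁.IsSimple) (h₂ : G₂.IsSimple) :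
    ObtainableUpToIso SimpleLocalStep G₁ G₂ := by
  obtain ⟨H, hH, ⟨φ⟩⟩ := h
  have hs : H.IsSimple := fun v hv => h₂ (φ v) (φ.map_rel_iff.2 hv)
  refine ⟨H, ?_, ⟨φ⟩⟩
  simpa only [h₁.removeLoops_eq, hs.removeLoops_eq] using reflTransGen_removeLoops hH

theorem ObtainableUpToIso.of_simpleLocalStep {G₁ : LoopedSimpleGraph V₁}
    {G₂ : LoopedSimpleGraph V₂} (h : ObtainableUpToIso SimpleLocalStep G₁ G₂) :
    ObtainableUpToIso ComplementStep G₁ G₂ := by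
  obtain ⟨H, hH, φ⟩ := h
  refine ⟨H, ReflTransGen.mono ?_ _ _ hH, φ⟩
  rintro _ _ ⟨v⟩
  exact .simpleLocal _ v

end Reach

end LoopedSimpleGraph

/-! ### Combinatorics of the crown -/

/-- In a `3`-regular bipartite graph in which the neighborhoods of distinct vertices on one side
have an even number of common elements, each component is `K₄,₄` minus a perfect matching. -/
theorem exists_crown {V Y : Type*} [DecidableEq V] [DecidableEq Y] (N : Y → Finset V)
    (N' : V → Finset Y)
    (P : Y → Prop) (hN : ∀ v y, v ∈ N y ↔ y ∈ N' v) (hP : ∀ y, P y → (N y).card = 3)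
    (hQ : ∀ y v, P y → v ∈ N y → (N' v).card = 3 ∧ ∀ y' ∈ N' v, P y')
    (hE : ∀ y y', P y → P y' → y ≠ y' → Even (N y ∩ N y').card) (y₀ : Y) (hy₀ : P y₀) :
    ∃ (v : Fin 4 → V) (y : Fin 4 → Y), Function.Injective v ∧ Function.Injective y ∧
      (∀ j, P (y j)) ∧ ∀ i j, i ≠ j → v i ∈ N (y j) := by
  -- Distinct neighborhoods meet in an even number of at most three elements: one common element
  -- forces a second (`two`), and three are impossible (`three`).
  have two : ∀ y y' v, P y → P y' → y ≠ y' → v ∈ N y → v ∈ N y' →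
      ∃ w, w ≠ v ∧ w ∈ N y ∧ w ∈ N y' := by
    intro y y' v hy hy' hne h h'
    by_contra! hcon
    have h1 : N y ∩ N y' = {v} := by
      ext w
      simp only [Finset.mem_inter, Finset.mem_singleton]
      constructor
      · rintro ⟨h2, h3⟩
        by_contra h4
        exact hcon w h4 h2 h3
      · rintro rfl
        exact ⟨h, h'⟩
    have := hE y y' hy hy' hne
    rw [h1] at this
    simp at this
  have three : ∀ y y' u v w, P y → P y' → y ≠ y' → u ≠ v → u ≠ w → v ≠ w →
      u ∈ N y → v ∈ N y → w ∈ N y → u ∈ N y' → v ∈ N y' → w ∉ N y' := by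
    intro y y' u v w hy hy' hne huv huw hvw h1 h2 h3 h4 h5 h6
    have hsub : ({u, v, w} : Finset V) ⊆ N y ∩ N y' := by
      intro x
      simp only [Finset.mem_inter, Finset.mem_insert, Finset.mem_singleton]
      rintro (rfl | rfl | rfl) <;> exact ⟨by assumption, by assumption⟩
    have h7 := Finset.card_le_card hsub
    rw [Finset.card_eq_three.2 ⟨u, v, w, huv, huw, hvw, rfl⟩] at h7
    have h8 := Finset.card_le_card (Finset.inter_subset_left : N y ∩ N y' ⊆ N y)
    rw [hP y hy] at h8
    have h9 := hE y y' hy hy' hne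
    rw [le_antisymm h8 h7] at h9
    exact absurd h9 (by decide)
  obtain ⟨v₁, v₂, v₃, h12, h13, h23, hN0⟩ := Finset.card_eq_three.1 (hP y₀ hy₀)
  have hmem : ∀ v, v ∈ N y₀ ↔ v = v₁ ∨ v = v₂ ∨ v = v₃ := by simp [hN0]
  have m1 := (hmem v₁).2 (by simp)
  have m2 := (hmem v₂).2 (by simp)
  have m3 := (hmem v₃).2 (by simp)
  have pair : ∀ v ∈ N y₀, ∃ a b, a ≠ b ∧ a ≠ y₀ ∧ b ≠ y₀ ∧ P a ∧ P b ∧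
      ∀ y, (v ∈ N y ↔ y = y₀ ∨ y = a ∨ y = b) := by
    intro v hv
    obtain ⟨hc, hPv⟩ := hQ y₀ v hy₀ hv
    have h0 : y₀ ∈ N' v := (hN _ _).1 hv
    have hc' : ((N' v).erase y₀).card = 2 := by rw [Finset.card_erase_of_mem h0, hc]
    obtain ⟨a, b, hab, hab'⟩ := Finset.card_eq_two.1 hc'
    have ha : a ∈ (N' v).erase y₀ := by simp [hab']
    have hb : b ∈ (N' v).erase y₀ := by simp [hab']
    rw [Finset.mem_erase] at ha hb
    refine ⟨a, b, hab, ha.1, hb.1, hPv _ ha.2, hPv _ hb.2, fun y => ?_⟩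
    have : y ∈ (N' v).erase y₀ ↔ y = a ∨ y = b := by simp [hab']
    rw [Finset.mem_erase] at this
    rw [hN]
    by_cases hy : y = y₀
    · subst hy; simp [h0]
    · simpa [hy] using this
  obtain ⟨a₁, b₁, hab₁, ha₁, hb₁, hPa₁, hPb₁, e₁⟩ := pair v₁ m1
  obtain ⟨a₂, b₂, hab₂, ha₂, hb₂, hPa₂, hPb₂, e₂⟩ := pair v₂ m2
  obtain ⟨a₃, b₃, hab₃, ha₃, hb₃, hPa₃, hPb₃, e₃⟩ := pair v₃ m3
  -- A further neighbor of one of the `vᵢ` contains exactly one of the other two, since it meets `N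
  -- y₀` in exactly two elements.
  have t1 : ∀ y, P y → y ≠ y₀ → v₁ ∈ N y → (v₂ ∈ N y ↔ v₃ ∉ N y) := by
    intro y hy hne h
    have := three y₀ y v₁ v₂ v₃ hy₀ hy hne.symm h12 h13 h23 m1 m2 m3 h
    obtain ⟨w, hw, hw', hw''⟩ := two y₀ y v₁ hy₀ hy hne.symm m1 h
    rw [hmem] at hw'
    grind
  have t2 : ∀ y, P y → y ≠ y₀ → v₂ ∈ N y → (v₁ ∈ N y ↔ v₃ ∉ N y) := by
    intro y hy hne h
    have := three y₀ y v₁ v₂ v₃ hy₀ hy hne.symm h12 h13 h23 m1 m2 m3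
    obtain ⟨w, hw, hw', hw''⟩ := two y₀ y v₂ hy₀ hy hne.symm m2 h
    rw [hmem] at hw'
    grind
  have t3 : ∀ y, P y → y ≠ y₀ → v₃ ∈ N y → (v₁ ∈ N y ↔ v₂ ∉ N y) := by
    intro y hy hne h
    have := three y₀ y v₁ v₂ v₃ hy₀ hy hne.symm h12 h13 h23 m1 m2 m3
    obtain ⟨w, hw, hw', hw''⟩ := two y₀ y v₃ hy₀ hy hne.symm m3 h
    rw [hmem] at hw'
    grind
  -- `yᵢ` is adjacent to the two elements of `N y₀` other than `vᵢ`.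
  obtain ⟨y₁, y₂, y₃, hP1, hP2, hP3, h01, h02, h03, n11, n12, n13, n21, n22, n23, n31, n32, n33⟩ :
      ∃ y₁ y₂ y₃, P y₁ ∧ P y₂ ∧ P y₃ ∧ y₁ ≠ y₀ ∧ y₂ ≠ y₀ ∧ y₃ ≠ y₀ ∧
        v₁ ∉ N y₁ ∧ v₁ ∈ N y₂ ∧ v₁ ∈ N y₃ ∧ v₂ ∈ N y₁ ∧ v₂ ∉ N y₂ ∧ v₂ ∈ N y₃ ∧
        v₃ ∈ N y₁ ∧ v₃ ∈ N y₂ ∧ v₃ ∉ N y₃ := by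
    have s1 := t1 a₁ hPa₁ ha₁ ((e₁ _).2 (by simp))
    have s1' := t1 b₁ hPb₁ hb₁ ((e₁ _).2 (by simp))
    have s2 := t2 a₂ hPa₂ ha₂ ((e₂ _).2 (by simp))
    have s2' := t2 b₂ hPb₂ hb₂ ((e₂ _).2 (by simp))
    have s3 := t3 a₃ hPa₃ ha₃ ((e₃ _).2 (by simp))
    have s3' := t3 b₃ hPb₃ hb₃ ((e₃ _).2 (by simp))
    obtain ⟨y₂, hP2, h02, n12, n22, n32⟩ : ∃ y, P y ∧ y ≠ y₀ ∧ v₁ ∈ N y ∧ v₂ ∉ N y ∧ v₃ ∈ N y := by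
      simp only [e₁, e₂, e₃] at *
      by_cases h : a₁ = a₃ ∨ a₁ = b₃
      · exact ⟨a₁, hPa₁, ha₁, by grind⟩
      · exact ⟨b₁, hPb₁, hb₁, by grind⟩
    obtain ⟨y₃, hP3, h03, n13, n23, n33⟩ : ∃ y, P y ∧ y ≠ y₀ ∧ v₁ ∈ N y ∧ v₂ ∈ N y ∧ v₃ ∉ N y := by
      simp only [e₁, e₂, e₃] at *
      by_cases h : a₁ = a₂ ∨ a₁ = b₂
      · exact ⟨a₁, hPa₁, ha₁, by grind⟩
      · exact ⟨b₁, hPb₁, hb₁, by grind⟩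
    obtain ⟨y₁, hP1, h01, n11, n21, n31⟩ : ∃ y, P y ∧ y ≠ y₀ ∧ v₁ ∉ N y ∧ v₂ ∈ N y ∧ v₃ ∈ N y := by
      simp only [e₁, e₂, e₃] at *
      by_cases h : a₂ = a₃ ∨ a₂ = b₃
      · exact ⟨a₂, hPa₂, ha₂, by grind⟩
      · exact ⟨b₂, hPb₂, hb₂, by grind⟩
    exact ⟨y₁, y₂, y₃, hP1, hP2, hP3, h01, h02, h03, n11, n12, n13, n21, n22, n23, n31, n32, n33⟩
  have d12 : y₁ ≠ y₂ := by rintro rfl; exact n11 n12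
  have d13 : y₁ ≠ y₃ := by rintro rfl; exact n11 n13
  have d23 : y₂ ≠ y₃ := by rintro rfl; exact n22 n23
  -- The fourth vertex, opposite `y₀`, is the second common element of `y₂` and `y₃`. It lies in `N
  -- y₁` because `y₁` and `y₂` share an element besides `v₃`, and `N y₂ = {v₁, v₃, w}`.
  obtain ⟨w, hw1, w2, w3⟩ := two y₂ y₃ v₁ hP2 hP3 d23 n12 n13
  have hw2 : w ≠ v₂ := by rintro rfl; exact n22 w2
  have hw3 : w ≠ v₃ := by rintro rfl; exact n33 w3
  have w1 : w ∈ N y₁ := by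
    obtain ⟨w', hw', w'1, w'2⟩ := two y₁ y₂ v₃ hP1 hP2 d12 n31 n32
    have hw'1 : w' ≠ v₁ := by rintro rfl; exact n11 w'1
    have hsub : ({v₁, v₃, w} : Finset V) ⊆ N y₂ := by
      intro x
      simp only [Finset.mem_insert, Finset.mem_singleton]
      rintro (rfl | rfl | rfl) <;> assumption
    have heq := Finset.eq_of_subset_of_card_le hsub (by
      rw [hP _ hP2, Finset.card_eq_three.2 ⟨v₁, v₃, w, h13, hw1.symm, hw3.symm, rfl⟩])
    rw [← heq] at w'2
    simp only [Finset.mem_insert, Finset.mem_singleton] at w'2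
    obtain rfl : w' = w := by tauto
    exact w'1
  refine ⟨![w, v₁, v₂, v₃], ![y₀, y₁, y₂, y₃], ?_, ?_, ?_, ?_⟩
  · intro i j
    fin_cases i <;> fin_cases j <;> simp [*, Ne.symm, hw1.symm, hw2.symm, hw3.symm, h12.symm,
      h13.symm, h23.symm]
  · intro i j
    fin_cases i <;> fin_cases j <;> simp [*, h01.symm, h02.symm, h03.symm, d12.symm,
      d13.symm, d23.symm]
  · intro j
    fin_cases j <;> assumption
  · intro i j
    fin_cases i <;> fin_cases j <;> intro h <;> first | exact absurd rfl h | assumption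

/-- The terms `g i k` cancel in characteristic 2, so the hypothesis at `k` says that `g i j + g j i`
sums to zero around the triangle avoiding `k`. Such a function on edges is a coboundary; the
potential is normalized to vanish at 0. -/
theorem Fin.four_sum_triangle (g : Fin 4 → Fin 4 → ZMod 2)
    (h : ∀ k, ∑ i ∈ Finset.univ.erase k, (∑ j ∈ Finset.univ.erase i, g i j + g i k) = 0)
    (i j : Fin 4) (hij : i ≠ j) :
    g i j + g j i = (if i = 0 then 0 else g 0 i + g i 0) + (if j = 0 then 0 else g 0 j + g j 0) := by
  have two : ∀ x : ZMod 2, x + x = 0 := CharTwo.add_self_eq_zero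
  have e0 : (Finset.univ.erase 0 : Finset (Fin 4)) = {1, 2, 3} := by decide
  have e1 : (Finset.univ.erase 1 : Finset (Fin 4)) = {0, 2, 3} := by decide
  have e2 : (Finset.univ.erase 2 : Finset (Fin 4)) = {0, 1, 3} := by decide
  have e3 : (Finset.univ.erase 3 : Finset (Fin 4)) = {0, 1, 2} := by decide
  have s123 : ∀ f : Fin 4 → ZMod 2, ∑ i ∈ {1, 2, 3}, f i = f 1 + f 2 + f 3 := by
    intro f; simp [add_assoc]
  have s023 : ∀ f : Fin 4 → ZMod 2, ∑ i ∈ {0, 2, 3}, f i = f 0 + f 2 + f 3 := by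
    intro f; simp [add_assoc]
  have s013 : ∀ f : Fin 4 → ZMod 2, ∑ i ∈ {0, 1, 3}, f i = f 0 + f 1 + f 3 := by
    intro f; simp [add_assoc]
  have s012 : ∀ f : Fin 4 → ZMod 2, ∑ i ∈ {0, 1, 2}, f i = f 0 + f 1 + f 2 := by
    intro f; simp [add_assoc]
  have h1 := h 1
  have h2 := h 2
  have h3 := h 3
  simp only [e0, e1, e2, e3, s123, s023, s013, s012] at h1 h2 h3
  fin_cases i <;> fin_cases j <;> simp at hij ⊢
  all_goals grind

/-! ### Isotropy, and how a bijection distributes triples -/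

namespace LoopedSimpleGraph

open ColumnKind

variable {V V₁ V₂ : Type*}

section Isotropy

theorem columnKind_exhaust : ∀ i j l k : ColumnKind, i ≠ j → i ≠ l → j ≠ l →
    k = i ∨ k = j ∨ k = l := by
  decide

theorem adjMatrix_symm (G : LoopedSimpleGraph V) (u v : V) :
    G.adjMatrix u v = G.adjMatrix v u := by
  have : G.Adj u v ↔ G.Adj v u := ⟨G.symm _ _, G.symm _ _⟩
  by_cases h : G.Adj v u <;> simp [adjMatrix, this, h]

/-- The cycle space is totally isotropic. -/
theorem cycleSpace_isotropic [Fintype V] {G : LoopedSimpleGraph V} {f g : V × ColumnKind → ZMod 2}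
    (hf : f ∈ G.cycleSpace) (hg : g ∈ G.cycleSpace) :
    ∑ x, g x * (∑ k, f (x.1, k) + f x) = 0 := by
  have two : ∀ x : ZMod 2, x + x = 0 := CharTwo.add_self_eq_zero
  rw [mem_cycleSpace_iff] at hf hg
  -- On each triple the form is symplectic in the coordinates φ+ψ and χ+ψ. The cycle equations
  -- express the first through the second by `A(G)`, whose symmetry makes the total vanish.
  have h1 : ∀ u, ∑ k, g (u, k) * (∑ k, f (u, k) + f (u, k)) =
      (f (u, phi) + f (u, psi)) * (g (u, chi) + g (u, psi)) +
      (f (u, chi) + f (u, psi)) * (g (u, phi) + g (u, psi)) := by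
    intro u
    simp only [sum_columnKind]
    linear_combination two (g (u, phi) * f (u, phi)) + two (g (u, chi) * f (u, chi))
  have h2 : ∀ u, (f (u, phi) + f (u, psi)) * (g (u, chi) + g (u, psi)) +
      (f (u, chi) + f (u, psi)) * (g (u, phi) + g (u, psi)) =
      ∑ w, G.adjMatrix u w * (f (w, chi) + f (w, psi)) * (g (u, chi) + g (u, psi)) +
      ∑ w, G.adjMatrix u w * (g (w, chi) + g (w, psi)) * (f (u, chi) + f (u, psi)) := by
    intro u
    rw [← Finset.sum_mul, ← Finset.sum_mul]
    have hf' := CharTwo.add_eq_zero.1 (hf u)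
    have hg' := CharTwo.add_eq_zero.1 (hg u)
    rw [hf', hg']
    ring
  rw [Fintype.sum_prod_type]
  simp only [h1, h2, Finset.sum_add_distrib]
  have h3 : ∑ u, ∑ w, G.adjMatrix u w * (g (w, chi) + g (w, psi)) * (f (u, chi) + f (u, psi)) =
      ∑ u, ∑ w, G.adjMatrix u w * (f (w, chi) + f (w, psi)) * (g (u, chi) + g (u, psi)) := by
    rw [Finset.sum_comm]
    refine Finset.sum_congr rfl fun u _ => Finset.sum_congr rfl fun w _ => ?_
    rw [adjMatrix_symm]
    ring
  rw [h3]
  exact two _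

open scoped Classical in
theorem triple_mem_cycleSpace [Fintype V] (G : LoopedSimpleGraph V) (v : V) :
    (fun x : V × ColumnKind => if x.1 = v then (1 : ZMod 2) else 0) ∈ G.cycleSpace := by
  have two : ∀ x : ZMod 2, x + x = 0 := CharTwo.add_self_eq_zero
  rw [mem_cycleSpace_iff]
  simp [two]

open scoped Classical in
theorem CarriesCycles.fiber_mem_cycleSpace [Fintype V₁] [Fintype V₂] {G : LoopedSimpleGraph V₁}
    {H : LoopedSimpleGraph V₂} {e : V₁ × ColumnKind ≃ V₂ × ColumnKind} (h : CarriesCycles G H e)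
    (y : V₂) : (fun x => if (e x).1 = y then (1 : ZMod 2) else 0) ∈ G.cycleSpace :=
  (h _).1 (triple_mem_cycleSpace H y)

theorem eq_or_eq_or_eq_of_fst_eq (e : V₁ × ColumnKind ≃ V₂ × ColumnKind) {y : V₂}
    {a b c x : V₁ × ColumnKind} (hab : a ≠ b) (hac : a ≠ c) (hbc : b ≠ c) (ha : (e a).1 = y)
    (hb : (e b).1 = y) (hc : (e c).1 = y) (hx : (e x).1 = y) : x = a ∨ x = b ∨ x = c := by
  have key : ∀ u w, (e u).1 = y → (e w).1 = y → (u = w ↔ (e u).2 = (e w).2) := by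
    intro u w hu hw
    rw [← e.apply_eq_iff_eq, Prod.ext_iff, hu, hw]
    simp
  rw [key x a hx ha, key x b hx hb, key x c hx hc]
  exact columnKind_exhaust _ _ _ _ (mt (key a b ha hb).2 hab) (mt (key a c ha hc).2 hac)
    (mt (key b c hb hc).2 hbc)

/-- The triple of `v` is mapped into a single triple. -/
def IsUniform (e : V₁ × ColumnKind ≃ V₂ × ColumnKind) (v : V₁) : Prop :=
  ∀ i j, (e (v, i)).1 = (e (v, j)).1

/-- The triple of `v` is mapped into three different triples. -/
def IsSpread (e : V₁ × ColumnKind ≃ V₂ × ColumnKind) (v : V₁) : Prop :=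
  Function.Injective fun k => (e (v, k)).1

theorem IsSpread.not_isUniform {e : V₁ × ColumnKind ≃ V₂ × ColumnKind} {v : V₁}
    (h : IsSpread e v) : ¬ IsUniform e v :=
  fun h' => absurd (h (h' phi chi)) (by decide)

/-- An injection between two triples is onto, so uniformity of `y` under `e.symm` passes to the
source triple. -/
theorem IsUniform.of_symm {e : V₁ × ColumnKind ≃ V₂ × ColumnKind} {y : V₂}
    (h : IsUniform e.symm y) (k : ColumnKind) : IsUniform e (e.symm (y, k)).1 := by
  have key : ∀ i, (e ((e.symm (y, k)).1, i)).1 = y := by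
    have hinj : Function.Injective fun i => (e.symm (y, i)).2 := by
      intro i j hij
      have := e.symm.injective (Prod.ext (h i j) hij)
      exact (Prod.mk.inj this).2
    intro i
    obtain ⟨j, hj⟩ := Finite.surjective_of_injective hinj i
    have : ((e.symm (y, k)).1, i) = e.symm (y, j) := Prod.ext (h k j) hj.symm
    rw [this, e.apply_symm_apply]
  intro i j
  rw [key, key]

theorem IsUniform.symm_of_apply {e : V₁ × ColumnKind ≃ V₂ × ColumnKind} {v : V₁}
    (h : IsUniform e v) (k : ColumnKind) : IsUniform e.symm (e (v, k)).1 :=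
  IsUniform.of_symm (e := e.symm) h k

theorem isCompatible_of_isUniform [Finite V₁] {e : V₁ × ColumnKind ≃ V₂ × ColumnKind}
    (h : ∀ v, IsUniform e v) : IsCompatible e := by
  have hsymm : ∀ y, IsUniform e.symm y := by
    intro y
    have := (h (e.symm (y, phi)).1).symm_of_apply (e.symm (y, phi)).2
    simpa using this
  let b : V₁ ≃ V₂ :=
    { toFun := fun v => (e (v, phi)).1
      invFun := fun y => (e.symm (y, phi)).1
      left_inv := fun v => by
        have := hsymm (e (v, phi)).1 phi (e (v, phi)).2
        simpa using this
      right_inv := fun y => by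
        have := h (e.symm (y, phi)).1 phi (e.symm (y, phi)).2
        simpa using this }
  have hinj : ∀ v, Function.Injective fun i => (e (v, i)).2 := by
    intro v i j hij
    exact (Prod.mk.inj (e.injective (Prod.ext (h v i j) hij))).2
  refine ⟨b, fun v => Equiv.ofBijective _ (Finite.injective_iff_bijective.1 (hinj v)), ?_⟩
  intro v i
  exact Prod.ext (h v i phi) rfl

end Isotropy

/-! ### Improving an isomorphism until it is compatible -/

section Improve

open scoped Classical

variable [Fintype V₁] [Fintype V₂] {G : LoopedSimpleGraph V₁}
    {H : LoopedSimpleGraph V₂} {e : V₁ × ColumnKind ≃ V₂ × ColumnKind}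

theorem CarriesCycles.of_involutive (h : CarriesCycles G H e)
    {s : Equiv.Perm (V₁ × ColumnKind)} (hs : Function.Involutive s)
    (hG : ∀ g ∈ G.cycleSpace, g ∘ s ∈ G.cycleSpace) : CarriesCycles G H (s.trans e) := by
  refine CarriesCycles.trans (fun g => ⟨hG g, fun hg => ?_⟩) h
  have := hG _ hg
  rwa [Function.comp_assoc, hs.comp_self, Function.comp_id] at this

/-- If exactly two elements of a triple are mapped into one triple, then exchanging two parallel
elements gives an isomorphism that respects more triples. -/
theorem CarriesCycles.exists_improvement_of_pair (h : CarriesCycles G H e)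
    {a b c : V₁ × ColumnKind} (hab : a ≠ b) (hab' : a.1 = b.1) (hc : c.1 ≠ a.1)
    (heb : (e b).1 = (e a).1) (hec : (e c).1 = (e a).1) :
    ∃ e', CarriesCycles G H e' ∧ (∀ v, IsUniform e v → IsUniform e' v) ∧
      ∃ v, IsUniform e' v ∧ ¬ IsUniform e v := by
  have two : ∀ x : ZMod 2, x + x = 0 := CharTwo.add_self_eq_zero
  have hac : a ≠ c := by rintro rfl; exact hc rfl
  have hbc : b ≠ c := by rintro rfl; exact hc hab'.symm
  obtain ⟨k, hka, hkb⟩ : ∃ k, k ≠ a.2 ∧ k ≠ b.2 := by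
    have : ∀ i j : ColumnKind, ∃ k, k ≠ i ∧ k ≠ j := by decide
    exact this _ _
  set d : V₁ × ColumnKind := (a.1, k) with hd
  have had : a ≠ d := fun h => hka (congrArg Prod.snd h).symm
  have hbd : b ≠ d := fun h => hkb (congrArg Prod.snd h).symm
  have hcd : c ≠ d := fun h => hc (by rw [h])
  have hfib : ∀ x, (e x).1 = (e a).1 ↔ x = a ∨ x = b ∨ x = c := fun x =>
    ⟨eq_or_eq_or_eq_of_fst_eq e hab hac hbc rfl heb hec, by rintro (rfl | rfl | rfl) <;> simp [*]⟩
  have htri : ∀ x : V₁ × ColumnKind, x.1 = a.1 ↔ x = a ∨ x = b ∨ x = d := fun x =>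
    ⟨eq_or_eq_or_eq_of_fst_eq (Equiv.refl _) hab had hbd rfl hab'.symm rfl,
      by rintro (rfl | rfl | rfl) <;> simp [*]⟩
  refine ⟨(Equiv.swap c d).trans e, h.of_involutive (Equiv.swap_apply_self c d) ?_, ?_, a.1, ?_, ?_⟩
  · intro g hg
    -- `{a, b, c}` is the preimage of a triple and `{a, b, d}` is a triple. Both are cycles, hence
    -- so is their sum `{c, d}`, and the swap changes `g` by a multiple of it.
    have : g ∘ Equiv.swap c d = g + (g c + g d) •
        ((fun x => if (e x).1 = (e a).1 then (1 : ZMod 2) else 0) +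
          fun x => if x.1 = a.1 then (1 : ZMod 2) else 0) := by
      ext x
      simp only [Function.comp_apply, Pi.add_apply, Pi.smul_apply, smul_eq_mul, hfib, htri]
      by_cases hxa : x = a
      · subst hxa
        simp [Equiv.swap_apply_of_ne_of_ne hac had, two]
      by_cases hxb : x = b
      · subst hxb
        simp [Equiv.swap_apply_of_ne_of_ne hbc hbd, two]
      by_cases hxc : x = c
      · subst hxc
        simp only [Equiv.swap_apply_left, hxa, hxb, hcd, or_true, or_false, if_true, if_false]
        linear_combination -two (g x)
      by_cases hxd : x = d
      · rw [hxd] at hxa hxb hxc ⊢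
        simp only [Equiv.swap_apply_right, hxa, hxb, hxc, or_true, or_false, if_true, if_false]
        linear_combination -two (g d)
      · simp [hxa, hxb, hxc, hxd, Equiv.swap_apply_of_ne_of_ne hxc hxd]
    rw [this]
    exact add_mem hg (Submodule.smul_mem _ _ (add_mem (h.fiber_mem_cycleSpace _)
      (triple_mem_cycleSpace G _)))
  · intro v hv
    have hva : v ≠ a.1 := by
      rintro rfl
      have : (e d).1 = (e a).1 := hv k a.2
      rw [hfib] at this
      rcases this with h | h | h
      exacts [had h.symm, hbd h.symm, hcd h.symm]
    have hvc : v ≠ c.1 := by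
      rintro rfl
      have := hv.symm_of_apply c.2 (e c).2 (e a).2
      simp only [Prod.mk.eta] at this
      rw [show ((e c).1, (e a).2) = e a from Prod.ext hec rfl] at this
      simp only [e.symm_apply_apply] at this
      exact hc this
    have : ∀ i, Equiv.swap c d (v, i) = (v, i) := fun i =>
      Equiv.swap_apply_of_ne_of_ne (fun h => hvc (congrArg Prod.fst h))
        fun h => hva (congrArg Prod.fst h)
    intro i j
    simp only [Equiv.trans_apply, this]
    exact hv i j
  · have : ∀ i, (e (Equiv.swap c d (a.1, i))).1 = (e a).1 := by
      intro i
      rw [hfib]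
      rcases (htri (a.1, i)).1 rfl with h | h | h <;> rw [h]
      · rw [Equiv.swap_apply_of_ne_of_ne hac had]; simp
      · rw [Equiv.swap_apply_of_ne_of_ne hbc hbd]; simp
      · simp
    intro i j
    simp only [Equiv.trans_apply, this]
  · intro hu
    have : (e d).1 = (e a).1 := hu k a.2
    rw [hfib] at this
    rcases this with h | h | h
    exacts [had h.symm, hbd h.symm, hcd h.symm]

/-- Exchanging the two families of triples of a crown is an automorphism. -/
theorem CarriesCycles.exists_improvement_of_crown (h : CarriesCycles G H e) {v : Fin 4 → V₁}
    {y : Fin 4 → V₂} (hv : Function.Injective v) (hy : Function.Injective y)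
    (hvy : ∀ i j, i ≠ j → ∃ k, (e (v i, k)).1 = y j) :
    ∃ e', CarriesCycles G H e' ∧ (∀ v, IsUniform e v → IsUniform e' v) ∧
      ∃ v, IsUniform e' v ∧ ¬ IsUniform e v := by
  -- `m i j` is the element of the triple of `v i` sent to the triple of `y j`; its diagonal values
  -- are arbitrary and never used.
  have hm' : ∀ i j, ∃ x : V₁ × ColumnKind, i ≠ j → x.1 = v i ∧ (e x).1 = y j := by
    intro i j
    by_cases hij : i = j
    · exact ⟨(v i, phi), fun h => absurd hij h⟩
    · obtain ⟨k, hk⟩ := hvy i j hij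
      exact ⟨(v i, k), fun _ => ⟨rfl, hk⟩⟩
  choose m hm using hm'
  have hm1 : ∀ i j, i ≠ j → (m i j).1 = v i := fun i j hij => (hm i j hij).1
  have hm2 : ∀ i j, i ≠ j → (e (m i j)).1 = y j := fun i j hij => (hm i j hij).2
  have hinj : ∀ i j i' j', i ≠ j → i' ≠ j' → m i j = m i' j' → i = i' ∧ j = j' := by
    intro i j i' j' h h' heq
    constructor
    · apply hv
      rw [← hm1 i j h, ← hm1 i' j' h', heq]
    · apply hy
      rw [← hm2 i j h, ← hm2 i' j' h', heq]
  have others : ∀ i : Fin 4, ∃ a b c, i ≠ a ∧ i ≠ b ∧ i ≠ c ∧ a ≠ b ∧ a ≠ c ∧ b ≠ c := by decide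
  have hrow : ∀ i x, x.1 = v i ↔ ∃ j, i ≠ j ∧ x = m i j := by
    intro i x
    constructor
    · intro hx
      obtain ⟨a, b, c, ha, hb, hc, hab, hac, hbc⟩ := others i
      rcases eq_or_eq_or_eq_of_fst_eq (Equiv.refl _)
        (fun h => hab (hinj _ _ _ _ ha hb h).2) (fun h => hac (hinj _ _ _ _ ha hc h).2)
        (fun h => hbc (hinj _ _ _ _ hb hc h).2) (hm1 i a ha) (hm1 i b hb) (hm1 i c hc) hx with
        h | h | h
      exacts [⟨a, ha, h⟩, ⟨b, hb, h⟩, ⟨c, hc, h⟩]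
    · rintro ⟨j, hj, rfl⟩
      exact hm1 i j hj
  have hcol : ∀ j x, (e x).1 = y j ↔ ∃ i, i ≠ j ∧ x = m i j := by
    intro j x
    constructor
    · intro hx
      obtain ⟨a, b, c, ha, hb, hc, hab, hac, hbc⟩ := others j
      rcases eq_or_eq_or_eq_of_fst_eq e
        (fun h => hab (hinj _ _ _ _ ha.symm hb.symm h).1)
        (fun h => hac (hinj _ _ _ _ ha.symm hc.symm h).1)
        (fun h => hbc (hinj _ _ _ _ hb.symm hc.symm h).1)
        (hm2 a j ha.symm) (hm2 b j hb.symm) (hm2 c j hc.symm) hx with h | h | h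
      exacts [⟨a, ha.symm, h⟩, ⟨b, hb.symm, h⟩, ⟨c, hc.symm, h⟩]
    · rintro ⟨i, hi, rfl⟩
      exact hm2 i j hi
  -- The transposition `m i j ↔ m j i`, identity elsewhere. It moves row `i`, the triple of `v i`,
  -- to column `i`, the preimage of the triple of `y i`.
  let s₀ : V₁ × ColumnKind → V₁ × ColumnKind := fun x =>
    if hx : ∃ p : Fin 4 × Fin 4, p.1 ≠ p.2 ∧ x = m p.1 p.2 then m hx.choose.2 hx.choose.1 else x
  have hs : ∀ i j, i ≠ j → s₀ (m i j) = m j i := by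
    intro i j hij
    have hx : ∃ p : Fin 4 × Fin 4, p.1 ≠ p.2 ∧ m i j = m p.1 p.2 := ⟨(i, j), hij, rfl⟩
    simp only [s₀, dif_pos hx]
    obtain ⟨h1, h2⟩ := hinj _ _ _ _ hij hx.choose_spec.1 hx.choose_spec.2
    rw [← h1, ← h2]
  have hs' : ∀ x, (¬ ∃ i j, i ≠ j ∧ x = m i j) → s₀ x = x := by
    intro x hx
    refine dif_neg ?_
    rintro ⟨p, hp⟩
    exact hx ⟨_, _, hp⟩
  have hinv : Function.Involutive s₀ := by
    intro x
    by_cases hx : ∃ i j, i ≠ j ∧ x = m i j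
    · obtain ⟨i, j, hij, rfl⟩ := hx
      rw [hs i j hij, hs j i hij.symm]
    · rw [hs' x hx, hs' x hx]
  refine ⟨hinv.toPerm.trans e, h.of_involutive hinv ?_, ?_, v 0, ?_, ?_⟩
  · intro g hg
    have hrowsum : ∀ i, ∑ k, g (v i, k) = ∑ j ∈ Finset.univ.erase i, g (m i j) := by
      intro i
      symm
      refine Finset.sum_bij (fun j _ => (m i j).2) (fun _ _ => Finset.mem_univ _) ?_ ?_ ?_
      · intro a ha b hb hab
        have ha' := (Finset.ne_of_mem_erase ha).symm
        have hb' := (Finset.ne_of_mem_erase hb).symm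
        exact (hinj i a i b ha' hb' (Prod.ext ((hm1 i a ha').trans (hm1 i b hb').symm) hab)).2
      · intro k _
        obtain ⟨j, hj, hj'⟩ := (hrow i (v i, k)).1 rfl
        exact ⟨j, by simp [hj.symm], by rw [← hj']⟩
      · intro j hj
        congr 1
        exact Prod.ext (hm1 i j (Finset.ne_of_mem_erase hj).symm) rfl
    have htri : ∀ k, ∑ i ∈ Finset.univ.erase k,
        (∑ j ∈ Finset.univ.erase i, g (m i j) + g (m i k)) = 0 := by
      intro k
      have hiso := cycleSpace_isotropic hg (h.fiber_mem_cycleSpace (y k))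
      simp only [ite_mul, one_mul, zero_mul] at hiso
      rw [← Finset.sum_filter] at hiso
      rw [← hiso]
      refine Finset.sum_bij (fun i _ => m i k) ?_ ?_ ?_ ?_
      · intro i hi
        simpa using hm2 i k (Finset.ne_of_mem_erase hi)
      · intro a ha b hb hab
        exact (hinj a k b k (Finset.ne_of_mem_erase ha) (Finset.ne_of_mem_erase hb) hab).1
      · intro x hx
        obtain ⟨i, hi, rfl⟩ := (hcol k x).1 (by simpa using hx)
        exact ⟨i, by simp [hi], rfl⟩
      · intro i hi
        rw [hm1 i k (Finset.ne_of_mem_erase hi), hrowsum]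
    have hF := Fin.four_sum_triangle (fun i j => g (m i j)) htri
    set c : Fin 4 → ZMod 2 := fun i => if i = 0 then 0 else g (m 0 i) + g (m i 0) with hc
    have hF' : ∀ i j, i ≠ j → g (m i j) + g (m j i) = c i + c j := hF
    -- Isotropy against the columns gives `g (m i j) + g (m j i) = c i + c j`, so transposing adds
    -- `c k` times row `k` plus column `k`, all of them cycles.
    have : g ∘ hinv.toPerm = g + ∑ k, c k •
        ((fun x => if x.1 = v k then (1 : ZMod 2) else 0) +
          fun x => if (e x).1 = y k then (1 : ZMod 2) else 0) := by
      ext x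
      simp only [Function.comp_apply, Pi.add_apply, Finset.sum_apply, Pi.smul_apply, smul_eq_mul,
        Function.Involutive.coe_toPerm]
      by_cases hx : ∃ i j, i ≠ j ∧ x = m i j
      · obtain ⟨i, j, hij, rfl⟩ := hx
        rw [hs i j hij, hm1 i j hij, hm2 i j hij]
        simp only [hv.eq_iff, hy.eq_iff, mul_add, mul_ite, mul_one, mul_zero,
          Finset.sum_add_distrib, Finset.sum_ite_eq, Finset.mem_univ, if_true]
        rw [← hF' i j hij, ← add_assoc, CharTwo.add_self_eq_zero, zero_add]
      · rw [hs' x hx]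
        have h1 : ∀ k, ¬ x.1 = v k := fun k hk => by
          obtain ⟨j, hj⟩ := (hrow k x).1 hk
          exact hx ⟨k, j, hj⟩
        have h2 : ∀ k, ¬ (e x).1 = y k := fun k hk => by
          obtain ⟨i, hi⟩ := (hcol k x).1 hk
          exact hx ⟨i, k, hi⟩
        simp [h1, h2]
    rw [this]
    exact add_mem hg (Submodule.sum_mem _ fun k _ => Submodule.smul_mem _ _
      (add_mem (triple_mem_cycleSpace G _) (h.fiber_mem_cycleSpace _)))
  · intro u hu
    have hfix : ∀ k, s₀ (u, k) = (u, k) := by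
      intro k
      apply hs'
      rintro ⟨i, j, hij, hk⟩
      have hui : u = v i := (congrArg Prod.fst hk).trans (hm1 i j hij)
      obtain ⟨a, b, c, ha, hb, -, hab, -⟩ := others i
      obtain ⟨k, hk⟩ := hvy i a ha
      obtain ⟨l, hl⟩ := hvy i b hb
      rw [hui] at hu
      exact hab (hy (by rw [← hk, ← hl, hu k l]))
    intro i j
    simp only [Equiv.trans_apply, Function.Involutive.coe_toPerm, hfix]
    exact hu i j
  · have : ∀ k, (e (s₀ (v 0, k))).1 = y 0 := by
      intro k
      obtain ⟨j, hj, hj'⟩ := (hrow 0 (v 0, k)).1 rfl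
      rw [hj', hs 0 j hj, hm2 j 0 hj.symm]
    intro i j
    simp only [Equiv.trans_apply, Function.Involutive.coe_toPerm, this]
  · intro hu
    obtain ⟨k, hk⟩ := hvy 0 1 (by decide)
    obtain ⟨l, hl⟩ := hvy 0 2 (by decide)
    exact absurd (hy (by rw [← hk, ← hl, hu k l]) : (1 : Fin 4) = 2) (by decide)

/-- Isotropy of the preimages of the two triples: since the source triples involved are spread, each
common one contributes exactly 1 to the form. -/
theorem CarriesCycles.even_card_inter (h : CarriesCycles G H e) {y y' : V₂} (hne : y ≠ y')
    (hsp : ∀ k, IsSpread e (e.symm (y', k)).1) (hy' : IsSpread e.symm y') :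
    Even ((Finset.univ.image fun k => (e.symm (y, k)).1) ∩
      (Finset.univ.image fun k => (e.symm (y', k)).1)).card := by
  have hiso := cycleSpace_isotropic (h.fiber_mem_cycleSpace y) (h.fiber_mem_cycleSpace y')
  rw [← e.symm.sum_comp, Fintype.sum_prod_type] at hiso
  simp only [e.apply_symm_apply, ite_mul, one_mul, zero_mul] at hiso
  rw [Finset.sum_eq_single y' (fun z _ hz => by simp [hz]) (by simp)] at hiso
  simp only [if_true, if_neg hne.symm, add_zero] at hiso
  set N := Finset.univ.image fun k => (e.symm (y, k)).1 with hN
  have hτ : ∀ k, ∑ l, (if (e ((e.symm (y', k)).1, l)).1 = y then (1 : ZMod 2) else 0) =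
      if (e.symm (y', k)).1 ∈ N then 1 else 0 := by
    intro k
    by_cases hk : (e.symm (y', k)).1 ∈ N
    · rw [if_pos hk]
      obtain ⟨i, -, hi⟩ := Finset.mem_image.1 hk
      have hl : (e ((e.symm (y', k)).1, (e.symm (y, i)).2)).1 = y := by
        rw [← hi, Prod.mk.eta, e.apply_symm_apply]
      rw [Finset.sum_eq_single (e.symm (y, i)).2 ?_ (by simp), if_pos hl]
      intro l _ hl'
      rw [if_neg]
      intro hl''
      exact hl' (hsp k (hl''.trans hl.symm))
    · rw [if_neg hk]
      refine Finset.sum_eq_zero fun l _ => if_neg fun hl => hk ?_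
      refine Finset.mem_image.2 ⟨(e ((e.symm (y', k)).1, l)).2, Finset.mem_univ _, ?_⟩
      rw [← hl, Prod.mk.eta, e.symm_apply_apply]
  simp only [hτ] at hiso
  rw [← Finset.sum_image (f := fun v => if v ∈ N then (1 : ZMod 2) else 0)
    (g := fun k => (e.symm (y', k)).1) (fun a _ b _ hab => hy' hab), ← Finset.sum_filter,
    Finset.sum_const, nsmul_eq_mul, mul_one, ZMod.natCast_eq_zero_iff_even,
    Finset.filter_mem_eq_inter, Finset.inter_comm] at hiso
  exact hiso

theorem CarriesCycles.exists_improvement (h : CarriesCycles G H e) {v₀ : V₁}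
    (hv₀ : ¬ IsUniform e v₀) :
    ∃ e', CarriesCycles G H e' ∧ (∀ v, IsUniform e v → IsUniform e' v) ∧
      ∃ v, IsUniform e' v ∧ ¬ IsUniform e v := by
  by_cases hpair : ∃ a b c : V₁ × ColumnKind, a ≠ b ∧ a.1 = b.1 ∧ c.1 ≠ a.1 ∧
      (e b).1 = (e a).1 ∧ (e c).1 = (e a).1
  · obtain ⟨a, b, c, h1, h2, h3, h4, h5⟩ := hpair
    exact h.exists_improvement_of_pair h1 h2 h3 h4 h5
  -- Without the pair configuration, the preimage of a target triple is either a whole triple or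
  -- spread over three, and the same follows for source triples.
  have hY : ∀ y, IsUniform e.symm y ∨ IsSpread e.symm y := by
    intro y
    by_contra! hcon
    obtain ⟨h1, h2⟩ := hcon
    simp only [IsSpread, Function.Injective] at h2
    push Not at h2
    obtain ⟨i, j, hij, hij'⟩ := h2
    refine h1 fun k l => ?_
    have key : ∀ k, (e.symm (y, k)).1 = (e.symm (y, i)).1 := by
      intro k
      by_contra hk
      exact hpair ⟨e.symm (y, i), e.symm (y, j), e.symm (y, k), by simpa using hij', hij, hk,
        by simp, by simp⟩
    rw [key k, key l]
  have hV : ∀ v, ¬ IsUniform e v → IsSpread e v := by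
    intro v hv i j hij
    by_contra hne
    rcases hY (e (v, i)).1 with hy | hy
    · refine hv ?_
      have := hy.of_symm (e (v, i)).2
      simpa using this
    · have h1 : (e.symm ((e (v, i)).1, (e (v, i)).2)).1 = v := by simp
      have h2 : (e.symm ((e (v, i)).1, (e (v, j)).2)).1 = v := by
        rw [show (e (v, i)).1 = (e (v, j)).1 from hij]
        simp
      have h3 : (e (v, i)).2 = (e (v, j)).2 := hy (h1.trans h2.symm)
      exact hne (Prod.mk.inj (e.injective (Prod.ext hij h3))).2
  have hYV : ∀ y k, IsSpread e.symm y → IsSpread e (e.symm (y, k)).1 := by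
    intro y k hy
    refine hV _ fun hu => hy.not_isUniform ?_
    have := hu.symm_of_apply (e.symm (y, k)).2
    simpa using this
  have hVY : ∀ v k, IsSpread e v → IsSpread e.symm (e (v, k)).1 := by
    intro v k hv
    refine (hY _).resolve_left fun hu => hv.not_isUniform ?_
    have := hu.of_symm (e (v, k)).2
    simpa using this
  have hcard : Fintype.card ColumnKind = 3 := rfl
  obtain ⟨v, y, hvi, hyi, -, hvy⟩ := exists_crown
    (fun y => Finset.univ.image fun k => (e.symm (y, k)).1)
    (fun v => Finset.univ.image fun k => (e (v, k)).1)
    (fun y => IsSpread e.symm y)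
    (by
      intro v y
      simp only [Finset.mem_image, Finset.mem_univ, true_and]
      constructor
      · rintro ⟨k, rfl⟩
        exact ⟨(e.symm (y, k)).2, by simp⟩
      · rintro ⟨k, rfl⟩
        exact ⟨(e (v, k)).2, by simp⟩)
    (fun y hy => by rw [Finset.card_image_of_injective _ hy, Finset.card_univ, hcard])
    (by
      intro y v hy hv
      obtain ⟨k, -, rfl⟩ := Finset.mem_image.1 hv
      have hs := hYV y k hy
      refine ⟨by rw [Finset.card_image_of_injective _ hs, Finset.card_univ, hcard], ?_⟩
      intro y' hy'
      obtain ⟨l, -, rfl⟩ := Finset.mem_image.1 hy'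
      exact hVY _ _ hs)
    (fun y y' hy hy' hne => h.even_card_inter hne (fun k => hYV y' k hy') hy')
    (e (v₀, phi)).1 (hVY _ _ (hV _ hv₀))
  refine h.exists_improvement_of_crown hvi hyi fun i j hij => ?_
  obtain ⟨k, -, hk⟩ := Finset.mem_image.1 (hvy i j hij)
  exact ⟨(e.symm (y j, k)).2, by simp [← hk]⟩

/-- Each improvement keeps the uniform triples and adds one, so the number of the others decreases.
-/
theorem CarriesCycles.exists_isCompatible (h : CarriesCycles G H e) :
    ∃ e', CarriesCycles G H e' ∧ IsCompatible e' := by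
  induction hn : (Finset.univ.filter fun v => ¬ IsUniform e v).card using
    Nat.strong_induction_on generalizing e with
  | _ n ih =>
    by_cases hu : ∀ v, IsUniform e v
    · exact ⟨e, h, isCompatible_of_isUniform hu⟩
    push Not at hu
    obtain ⟨v₀, hv₀⟩ := hu
    obtain ⟨e', he', hmono, v, hv, hv'⟩ := h.exists_improvement hv₀
    refine ih _ ?_ he' rfl
    rw [← hn]
    refine Finset.card_lt_card (Finset.ssubset_iff_of_subset ?_ |>.2 ⟨v, ?_, ?_⟩)
    · exact Finset.monotone_filter_right _ fun w _ hw hw' => hw (hmono w hw')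
    · simpa using hv'
    · simpa using hv

end Improve

end LoopedSimpleGraph

/-! ### The theorem -/

open LoopedSimpleGraph in
theorem theorem5p1 {V₁ V₂ : Type*} [Finite V₁] [Finite V₂]
    (G₁ : LoopedSimpleGraph V₁) (G₂ : LoopedSimpleGraph V₂) :
    ((∃ e : V₁ × ColumnKind ≃ V₂ × ColumnKind,
        IsMatroidIso G₁.isotropicMatroid G₂.isotropicMatroid e) →
      ∃ e : V₁ × ColumnKind ≃ V₂ × ColumnKind,
        IsMatroidIso G₁.isotropicMatroid G₂.isotropicMatroid e ∧
          LoopedSimpleGraph.IsCompatible e) ∧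
    ((∃ e : V₁ × ColumnKind ≃ V₂ × ColumnKind,
        IsMatroidIso G₁.isotropicMatroid G₂.isotropicMatroid e) ↔
      LoopedSimpleGraph.ObtainableUpToIso LoopedSimpleGraph.ComplementStep G₁ G₂) ∧
    (G₁.IsSimple → G₂.IsSimple →
      ((∃ e : V₁ × ColumnKind ≃ V₂ × ColumnKind,
          IsMatroidIso G₁.isotropicMatroid G₂.isotropicMatroid e) ↔
        LoopedSimpleGraph.ObtainableUpToIso LoopedSimpleGraph.SimpleLocalStep G₁ G₂)) := by
  have := Fintype.ofFinite V₁
  have := Fintype.ofFinite V₂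
  have hiso : (∃ e : V₁ × ColumnKind ≃ V₂ × ColumnKind,
      IsMatroidIso G₁.isotropicMatroid G₂.isotropicMatroid e) ↔
      ObtainableUpToIso ComplementStep G₁ G₂ := by
    simp only [isMatroidIso_iff]
    constructor
    · rintro ⟨e, he⟩
      obtain ⟨e', he', hc⟩ := he.exists_isCompatible
      exact obtainable_of_isCompatible he' hc
    · exact exists_carriesCycles_of_obtainable
  refine ⟨?_, hiso, fun h₁ h₂ => ?_⟩
  · simp only [isMatroidIso_iff]
    rintro ⟨e, he⟩
    exact he.exists_isCompatible
  · rw [hiso]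
    exact ⟨fun h => h.removeLoops h₁ h₂, fun h => h.of_simpleLocalStep⟩
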